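/- Let $(X,\mathcal B,m)$ be a measure space with a non-zero $\sigma$-finite measure $m$, and let $L$ be a (possibly unbounded) selfadjoint operator in the real or complex Hilbert space $L^2(X,m)$ that is bounded below. Let $E_0\in\mathbb R$ be the infimum of the spectrum of $L$, and let $(e^{-tL})_{t\ge 0}$ be the strongly continuous semigroup with generator $-L$. Assume that this semigroup is positivity preserving, i.e. for each $t>0$ and each $f\in L^2(X,m)$ with $f\ge 0$ $m$-almost everywhere one has $e^{-tL}f\ge 0$ $m$-almost everywhere. Then for all $f,g\in L^2(X,m)$ that are strictly positive (i.e. $f(x)>0$ and $g(x)>0$ for $m$-almost every $x\in X$) one has $\langle f,e^{-tL}g\rangle>0$ for all $t\ge 0$ and $$\lim_{t\to\infty}\frac{\log\langle f,e^{-tL}g\rangle}{t}=-E_0 .$$ -/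

import Mathlib

open MeasureTheory Filter Topology
open scoped NNReal InnerProductSpace ComplexOrder

namespace GroundState

section Hilbert

variable {𝕜 : Type*} [RCLike 𝕜] {H : Type*} [NormedAddCommGroup H] [InnerProductSpace 𝕜 H]

/-- The (possibly unbounded) operator `L` is bounded below: for some real `C`,
`⟨L x, x⟩ ≥ C ‖x‖²` for all `x` in the domain of `L`. -/
def IsBoundedBelow (L : H →ₗ.[𝕜] H) : Prop :=
  ∃ C : ℝ, ∀ x : L.domain, C * ‖(x : H)‖ ^ 2 ≤ RCLike.re ⟪L x, (x : H)⟫_𝕜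

/-- The resolvent set of `L`: all scalars `z` for which `L - z`, from the domain of `L` to `H`,
is a bijection with bounded inverse `R`. -/
def resolventSet (L : H →ₗ.[𝕜] H) : Set 𝕜 :=
  {z | ∃ R : H →L[𝕜] H, (∀ x : L.domain, R (L x - z • (x : H)) = x) ∧
    ∀ y : H, ∃ x : L.domain, (x : H) = R y ∧ L x - z • (x : H) = y}

/-- The spectrum of `L`. -/
def spectrum (L : H →ₗ.[𝕜] H) : Set 𝕜 := (resolventSet L)ᶜ

/-- The infimum `E₀` of the spectrum of `L`. The spectrum of a selfadjoint operator is real,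
so it is read as a set of real numbers. -/
noncomputable def groundStateEnergy (L : H →ₗ.[𝕜] H) : ℝ :=
  sInf {E : ℝ | (E : 𝕜) ∈ spectrum L}

/-- `T` is a strongly continuous one-parameter semigroup of bounded operators on `H`. -/
structure IsC0Semigroup (T : ℝ≥0 → H →L[𝕜] H) : Prop where
  map_zero : T 0 = 1
  map_add : ∀ s t : ℝ≥0, T (s + t) = T s * T t
  continuous : ∀ x : H, Continuous fun t : ℝ≥0 => T t x

/-- `-L` is the infinitesimal generator of `T`: `x` lies in the domain of `L` and `L x = y`
exactly when `(x - T t x) / t → y` as `t ↓ 0`. -/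
def IsGeneratedByNeg (L : H →ₗ.[𝕜] H) (T : ℝ≥0 → H →L[𝕜] H) : Prop :=
  ∀ x y : H, (x, y) ∈ L.graph ↔
    Tendsto (fun t : ℝ≥0 => (((t : ℝ) : 𝕜)⁻¹) • (x - T t x)) (𝓝[>] 0) (𝓝 y)

open Classical in
/-- The semigroup `t ↦ e^{-tL}`, `t ≥ 0`: the strongly continuous semigroup with generator `-L`.
A strongly continuous semigroup is determined by its generator, and one with generator `-L` exists
for every selfadjoint `L` that is bounded below. (The value is `0` if there is none.) -/
noncomputable def expNeg (L : H →ₗ.[𝕜] H) : ℝ≥0 → H →L[𝕜] H :=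
  if h : ∃ T : ℝ≥0 → H →L[𝕜] H, IsC0Semigroup T ∧ IsGeneratedByNeg L T then h.choose else 0

end Hilbert

section L2

variable {𝕜 : Type*} [RCLike 𝕜] {X : Type*} [MeasurableSpace X] {m : Measure X}

/-- A family of operators on `L²(X, m)` is positivity preserving: for each `t > 0` it maps
functions that are (real and) non-negative almost everywhere to such functions. -/
def IsPositivityPreserving (T : ℝ≥0 → Lp 𝕜 2 m →L[𝕜] Lp 𝕜 2 m) : Prop :=
  ∀ t : ℝ≥0, 0 < t → ∀ f : Lp 𝕜 2 m, (∀ᵐ x ∂m, 0 ≤ f x) → ∀ᵐ x ∂m, 0 ≤ T t f x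

/-- `f` is strictly positive: `f x` is (real and) `> 0` for almost every `x`. -/
def IsStrictlyPositive (f : Lp 𝕜 2 m) : Prop := ∀ᵐ x ∂m, 0 < f x

end L2

end GroundState

/-!
Write `T t = e^{-tL}` and let `E` be the infimum of the spectrum of `L`. The proof uses neither the
spectral theorem nor the functional calculus; it rests on four facts.

* `E` is the largest constant `C` with `⟨L x, x⟩ ≥ C ‖x‖²` on the domain of `L`
  (`isGreatest_groundStateEnergy`). If `L ≥ C` and `z < C`, then `L - z` is injective with closed and
  dense range, so `z` is in the resolvent set (`exists_resolvent`); if the best constant `C` were in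
  the resolvent set, the Cauchy-Schwarz inequality for the form of `L - C` would improve it.
* `L` does generate a strongly continuous semigroup, so that `expNeg L` is not the default
  value `0`. It is the strong limit of the exponentials of the Yosida approximations of `L`, hence
  symmetric, and it is determined by its generator (`expNeg_spec`). Grönwall's inequality for
  `‖T t x‖²` gives `‖T t‖ ≤ e^{-tE}`, and with it the upper bound `⟨f, T t g⟩ ≤ ‖f‖ ‖g‖ e^{-tE}`.
* By symmetry, `t ↦ ‖T t x‖` is logarithmically convex (`norm_sq_apply_add_le`). Consequently
  a bound `‖T s x‖ ≤ e^{μ s}` at arbitrarily large times `s` implies `‖T t x‖ ≤ K e^{μ t}` for all `t`,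
  and a bound of this kind always holds with `K = ‖x‖`.
* Let `h` be the minimum of `f` and `g`. Positivity gives `⟨f, T t g⟩ ≥ ⟨h, T t h⟩ = ‖T (t/2) h‖²`,
  which is positive since `T` is injective, again by convexity. Positivity also gives
  `‖T t u‖ ≤ ‖T t h‖` whenever `0 ≤ u ≤ h`, and the span of such `u` is dense because `h > 0`
  (`dense_dominatedBy`).

If `‖T s h‖ ≤ e^{μ s}` held for arbitrarily large `s` with some `μ < -E`, then by the last two facts
`‖T t u‖ ≤ e^{μ t} ‖u‖` for a dense set of `u`, hence for all `u`; differentiating at `t = 0` gives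
`L ≥ -μ > E`, which contradicts the first fact (`eventually_exp_lt_norm_apply`). So
`⟨f, T t g⟩ > e^{μ t}` for all large `t`, whatever `μ < -E`.
-/

namespace GroundState

/-! ### Resolvents of selfadjoint operators that are bounded below -/

section Resolvent

variable {𝕜 : Type*} [RCLike 𝕜] {H : Type*} [NormedAddCommGroup H] [InnerProductSpace 𝕜 H]
  {L : H →ₗ.[𝕜] H}

/-- `C` is a lower bound of the quadratic form of `L`, i.e. `L ≥ C` in the form sense. -/
def IsFormLowerBound (L : H →ₗ.[𝕜] H) (C : ℝ) : Prop :=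
  ∀ x : L.domain, C * ‖(x : H)‖ ^ 2 ≤ RCLike.re ⟪L x, (x : H)⟫_𝕜

lemma norm_le_norm_sub_smul {z ε : ℝ} (h : IsFormLowerBound L (z + ε)) (x : L.domain) :
    ε * ‖(x : H)‖ ≤ ‖L x - (z : 𝕜) • (x : H)‖ := by
  rcases eq_or_lt_of_le (norm_nonneg (x : H)) with h0 | h0
  · rw [← h0, mul_zero]; positivity
  have h1 := (RCLike.re_le_norm _).trans
    (norm_inner_le_norm (𝕜 := 𝕜) (L x - (z : 𝕜) • (x : H)) (x : H))
  have h2 : RCLike.re ⟪L x - (z : 𝕜) • (x : H), (x : H)⟫_𝕜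
      = RCLike.re ⟪L x, (x : H)⟫_𝕜 - z * ‖(x : H)‖ ^ 2 := by
    rw [inner_sub_left, inner_smul_left, inner_self_eq_norm_sq_to_K, RCLike.conj_ofReal, map_sub]
    norm_cast
  have h3 := h x
  refine le_of_mul_le_mul_right ?_ h0
  nlinarith

variable [CompleteSpace H]

lemma inner_map_comm (hL : IsSelfAdjoint L) (x y : L.domain) :
    ⟪L x, (y : H)⟫_𝕜 = ⟪(x : H), L y⟫_𝕜 := by
  have h := LinearPMap.adjoint_isFormalAdjoint hL.dense_domain
  rw [LinearPMap.isSelfAdjoint_def.mp hL] at h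
  exact h x y

/-- A selfadjoint operator is maximal among its formal adjoints. -/
lemma mem_graph_of_forall_inner (hL : IsSelfAdjoint L) {x y : H}
    (h : ∀ z : L.domain, ⟪y, (z : H)⟫_𝕜 = ⟪x, L z⟫_𝕜) : (x, y) ∈ L.graph := by
  have hx := LinearPMap.mem_adjoint_domain_of_exists x ⟨y, h⟩
  have hxy := LinearPMap.adjoint_apply_eq hL.dense_domain ⟨x, hx⟩ h
  rw [← LinearPMap.isSelfAdjoint_def.mp hL]
  exact (LinearPMap.mem_graph_iff _).2 ⟨⟨x, hx⟩, rfl, hxy⟩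

/-- If `L ≥ z + ε` with `ε > 0`, then `L - z` is bijective and its inverse has norm at most
`1 / ε`: it is bounded below, so its range is closed, and its range is dense because a vector
orthogonal to it is an eigenvector for `z`. -/
theorem exists_resolvent (hL : IsSelfAdjoint L) {z ε : ℝ} (hε : 0 < ε)
    (h : IsFormLowerBound L (z + ε)) :
    ∃ R : H →L[𝕜] H, ‖R‖ ≤ ε⁻¹ ∧ (∀ x : L.domain, R (L x - (z : 𝕜) • (x : H)) = x) ∧
      ∀ y : H, ∃ x : L.domain, (x : H) = R y ∧ L x - (z : 𝕜) • (x : H) = y := by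
  have hcl : IsClosed (L.graph : Set (H × H)) := hL.isClosed
  have : CompleteSpace L.graph := hcl.completeSpace_coe
  -- `L - z` as a bounded operator on the graph of `L`, which is complete
  let N : L.graph →L[𝕜] H :=
    (ContinuousLinearMap.snd 𝕜 H H - (z : 𝕜) • ContinuousLinearMap.fst 𝕜 H H).comp
      L.graph.subtypeL
  have hN : ∀ p : L.graph, N p = p.1.2 - (z : 𝕜) • p.1.1 := fun p => rfl
  have hb : ∀ p : L.graph, ε * ‖p.1.1‖ ≤ ‖N p‖ := by
    rintro ⟨⟨x, y⟩, hp⟩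
    obtain ⟨x', rfl, rfl⟩ := (LinearPMap.mem_graph_iff _).1 hp
    exact norm_le_norm_sub_smul h x'
  have hb1 : ∀ p : L.graph, ‖p.1.1‖ ≤ ε⁻¹ * ‖N p‖ := fun p => by
    rw [inv_mul_eq_div, le_div_iff₀' hε]; exact hb p
  have hK : ∀ p : L.graph, ‖p‖ ≤ ((ε⁻¹ + (1 + |z| * ε⁻¹)).toNNReal : ℝ) * ‖N p‖ := by
    intro p
    rw [Real.coe_toNNReal _ (by positivity)]
    have h2 : ‖p.1.2‖ ≤ ‖N p‖ + |z| * ‖p.1.1‖ := by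
      have : p.1.2 = N p + (z : 𝕜) • p.1.1 := by rw [hN]; abel
      calc ‖p.1.2‖ = ‖N p + (z : 𝕜) • p.1.1‖ := by rw [← this]
        _ ≤ _ := (norm_add_le _ _).trans (by rw [norm_smul, RCLike.norm_ofReal])
    have h3 := mul_le_mul_of_nonneg_left (hb1 p) (abs_nonneg z)
    have h4 : 0 ≤ |z| * ε⁻¹ := by positivity
    have h5 : 0 ≤ ε⁻¹ := by positivity
    have h6 := norm_nonneg (N p)
    change max ‖p.1.1‖ ‖p.1.2‖ ≤ _
    refine max_le ((hb1 p).trans ?_) (h2.trans ?_) <;> nlinarith [mul_nonneg h4 h6, mul_nonneg h5 h6]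
  have hanti := ContinuousLinearMap.antilipschitz_of_bound N hK
  have hclosed : IsClosed (Set.range N) := hanti.isClosed_range N.uniformContinuous
  have hrange : LinearMap.range N.toLinearMap = ⊤ := by
    have : CompleteSpace (LinearMap.range N.toLinearMap) := by
      have : IsClosed ((LinearMap.range N.toLinearMap : Submodule 𝕜 H) : Set H) := hclosed
      exact this.completeSpace_coe
    rw [← Submodule.orthogonal_eq_bot_iff, Submodule.eq_bot_iff]
    intro y hy
    -- `y` is orthogonal to the range of `L - z`, so it lies in the domain of `L` and `L y = z y`
    have hy' : ∀ x : L.domain, ⟪(z : 𝕜) • y, (x : H)⟫_𝕜 = ⟪y, L x⟫_𝕜 := by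
      intro x
      have := (Submodule.mem_orthogonal' _ _).1 hy _
        (LinearMap.mem_range_self N.toLinearMap ⟨_, L.mem_graph x⟩)
      change ⟪y, L x - (z : 𝕜) • (x : H)⟫_𝕜 = 0 at this
      rw [inner_sub_right, inner_smul_right, sub_eq_zero] at this
      rw [this, inner_smul_left, RCLike.conj_ofReal]
    have := hb ⟨_, mem_graph_of_forall_inner hL hy'⟩
    rw [hN, sub_self, norm_zero] at this
    exact norm_le_zero_iff.1 (nonpos_of_mul_nonpos_right this hε)
  have hsurj : Function.Surjective N := LinearMap.range_eq_top.1 hrange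
  let e := LinearEquiv.ofBijective N.toLinearMap ⟨hanti.injective, hsurj⟩
  have he : ∀ y, N (e.symm y) = y := fun y => e.apply_symm_apply y
  let R : H →L[𝕜] H := LinearMap.mkContinuous
    (LinearMap.fst 𝕜 H H ∘ₗ L.graph.subtype ∘ₗ e.symm.toLinearMap) ε⁻¹ fun y => by
      simpa [he] using hb1 (e.symm y)
  have hR : ∀ y, R y = (e.symm y).1.1 := fun y => rfl
  refine ⟨R, LinearMap.mkContinuous_norm_le _ (by positivity) _, fun x => ?_, fun y => ?_⟩
  · have : e ⟨_, L.mem_graph x⟩ = L x - (z : 𝕜) • (x : H) := rfl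
    rw [hR, ← this, e.symm_apply_apply]
  · obtain ⟨x, hx1, hx2⟩ := (LinearPMap.mem_graph_iff _).1 (e.symm y).2
    refine ⟨x, hx1, ?_⟩
    rw [hx1, hx2]
    exact he y

/-- The resolvent at a real point is symmetric. -/
lemma inner_resolvent_comm (hL : IsSelfAdjoint L) {z : ℝ} {R : H →L[𝕜] H}
    (hR : ∀ y : H, ∃ x : L.domain, (x : H) = R y ∧ L x - (z : 𝕜) • (x : H) = y) (x y : H) :
    ⟪R x, y⟫_𝕜 = ⟪x, R y⟫_𝕜 := by
  obtain ⟨u, hu, hu'⟩ := hR x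
  obtain ⟨v, hv, hv'⟩ := hR y
  nth_rw 1 [← hv']
  nth_rw 2 [← hu']
  rw [← hu, ← hv, inner_sub_left, inner_sub_right, inner_map_comm hL, inner_smul_left,
    inner_smul_right, RCLike.conj_ofReal]

end Resolvent

/-! ### The infimum of the spectrum and the quadratic form -/

section Spectrum

variable {𝕜 : Type*} [RCLike 𝕜] {H : Type*} [NormedAddCommGroup H] [InnerProductSpace 𝕜 H]
  [CompleteSpace H] {L : H →ₗ.[𝕜] H}

/-- If `L ≥ C` and `C` lies in the resolvent set, then the bound `C` can be improved:
with `R = (L - C)⁻¹`, the Cauchy-Schwarz inequality for the form of `L - C` gives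
`‖x‖² ≤ ‖R‖ ⟨(L - C) x, x⟩`. -/
lemma IsFormLowerBound.exists_gt (hL : IsSelfAdjoint L) {C : ℝ} (h : IsFormLowerBound L C)
    (hC : (C : 𝕜) ∈ resolventSet L) : ∃ C' > C, IsFormLowerBound L C' := by
  obtain ⟨R, hR1, hR2⟩ := hC
  have key : ∀ x : L.domain, ‖(x : H)‖ ^ 2 ≤
      ‖R‖ * (RCLike.re ⟪L x, (x : H)⟫_𝕜 - C * ‖(x : H)‖ ^ 2) := by
    intro x
    -- `w = R x`, so that `(L - C) w = x`
    obtain ⟨w, hw, hw'⟩ := hR2 x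
    set A : L.domain → H := fun v => L v - (C : 𝕜) • (v : H) with hA
    have hq : ∀ v : L.domain, RCLike.re ⟪A v, (v : H)⟫_𝕜
        = RCLike.re ⟪L v, (v : H)⟫_𝕜 - C * ‖(v : H)‖ ^ 2 := by
      intro v
      rw [hA]
      simp only
      rw [inner_sub_left, inner_smul_left, inner_self_eq_norm_sq_to_K, RCLike.conj_ofReal, map_sub]
      norm_cast
    have hpos : ∀ v : L.domain, 0 ≤ RCLike.re ⟪A v, (v : H)⟫_𝕜 := fun v => by
      rw [hq]; linarith [h v]
    have hAw : A w = x := hw'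
    have hwx : RCLike.re ⟪A w, (w : H)⟫_𝕜 ≤ ‖R‖ * ‖(x : H)‖ ^ 2 := by
      rw [hAw, hw]
      refine (RCLike.re_le_norm _).trans ((norm_inner_le_norm _ _).trans ?_)
      nlinarith [R.le_opNorm (x : H), norm_nonneg (x : H)]
    -- nonnegativity of the form of `L - C` at `x - s w`; below it is used with `s = 1 / ‖R‖`
    have hexp : ∀ s : ℝ, 0 ≤ RCLike.re ⟪A x, (x : H)⟫_𝕜 - 2 * s * ‖(x : H)‖ ^ 2
        + s ^ 2 * RCLike.re ⟪A w, (w : H)⟫_𝕜 := by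
      intro s
      have h1 := hpos (x - (s : 𝕜) • w)
      have h2 : A (x - (s : 𝕜) • w) = A x - (s : 𝕜) • A w := by
        simp only [hA, LinearPMap.map_sub, LinearPMap.map_smul,
          Submodule.coe_sub, Submodule.coe_smul, smul_sub, smul_comm (s : 𝕜) (C : 𝕜)]
        abel
      have h3 : ⟪A x, (w : H)⟫_𝕜 = ⟪(x : H), A w⟫_𝕜 := by
        simp only [hA]
        rw [inner_sub_left, inner_sub_right, inner_map_comm hL, inner_smul_left,
          inner_smul_right, RCLike.conj_ofReal]
      rw [h2, Submodule.coe_sub, Submodule.coe_smul] at h1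
      simp only [inner_sub_left, inner_sub_right, inner_smul_left, inner_smul_right,
        RCLike.conj_ofReal, h3, hAw, map_sub, RCLike.re_ofReal_mul, inner_self_eq_norm_sq] at h1
      rw [hAw]
      linarith
    rw [← hq]
    rcases eq_or_lt_of_le (norm_nonneg R) with h0 | h0
    · have hx0 : (x : H) = 0 := by
        rw [← hR1 x, norm_eq_zero.1 h0.symm]; rfl
      simp [hx0]
    · have := hexp ‖R‖⁻¹
      have h4 : ‖R‖⁻¹ ^ 2 * RCLike.re ⟪A w, (w : H)⟫_𝕜 ≤ ‖R‖⁻¹ * ‖(x : H)‖ ^ 2 := by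
        have := mul_le_mul_of_nonneg_left hwx (sq_nonneg ‖R‖⁻¹)
        refine this.trans (le_of_eq ?_)
        field_simp
      have h5 : ‖R‖⁻¹ * ‖(x : H)‖ ^ 2 ≤ RCLike.re ⟪A x, (x : H)⟫_𝕜 := by linarith
      rwa [inv_mul_le_iff₀ h0] at h5
  -- `‖R‖ + 1` instead of `‖R‖` avoids dividing by zero on the trivial space
  refine ⟨C + (‖R‖ + 1)⁻¹, by simp; positivity, fun x => ?_⟩
  have h1 := key x
  have h2 := h x
  have h3 : (‖R‖ + 1)⁻¹ * ‖(x : H)‖ ^ 2 ≤ RCLike.re ⟪L x, (x : H)⟫_𝕜 - C * ‖(x : H)‖ ^ 2 := by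
    rw [inv_mul_le_iff₀ (by positivity)]
    nlinarith
  linarith

/-- The infimum of the spectrum is the largest lower bound of the quadratic form. -/
theorem isGreatest_groundStateEnergy [Nontrivial H] (hL : IsSelfAdjoint L)
    (hbdd : IsBoundedBelow L) :
    IsGreatest {C : ℝ | IsFormLowerBound L C} (groundStateEnergy L) := by
  set S := {C : ℝ | IsFormLowerBound L C}
  have hne : S.Nonempty := hbdd
  obtain ⟨x, hx⟩ : ∃ x : L.domain, (x : H) ≠ 0 := by
    by_contra! hcon
    obtain ⟨y, hy⟩ := exists_ne (0 : H)
    have : L.domain = ⊥ := (Submodule.eq_bot_iff _).2 fun z hz => hcon ⟨z, hz⟩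
    have hd := hL.dense_domain
    rw [this] at hd
    have hc := hd.closure_eq
    rw [Submodule.bot_coe, closure_singleton] at hc
    exact hy ((Set.ext_iff.1 hc y).2 (Set.mem_univ y))
  have hxpos : 0 < ‖(x : H)‖ ^ 2 := by positivity
  have hba : BddAbove S :=
    ⟨RCLike.re ⟪L x, (x : H)⟫_𝕜 / ‖(x : H)‖ ^ 2, fun C hC => (le_div_iff₀ hxpos).2 (hC x)⟩
  have hmem : IsFormLowerBound L (sSup S) := by
    intro v
    rcases eq_or_ne (v : H) 0 with hv | hv
    · simp [hv]
    have hvpos : 0 < ‖(v : H)‖ ^ 2 := by positivity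
    rw [← le_div_iff₀ hvpos]
    exact csSup_le hne fun C hC => (le_div_iff₀ hvpos).2 (hC v)
  have hleast : IsLeast {E : ℝ | (E : 𝕜) ∈ spectrum L} (sSup S) := by
    refine ⟨fun hres => ?_, fun E hE => ?_⟩
    · obtain ⟨C', hC', hb⟩ := hmem.exists_gt hL hres
      exact absurd (le_csSup hba hb) (not_le.2 hC')
    · by_contra! hlt
      obtain ⟨R, -, hR⟩ := exists_resolvent hL (sub_pos.2 hlt)
        (by rwa [add_sub_cancel] : IsFormLowerBound L (E + (sSup S - E)))
      exact hE ⟨R, hR⟩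
  have : groundStateEnergy L = sSup S := hleast.csInf_eq
  rw [this]
  exact ⟨hmem, fun C hC => le_csSup hba hC⟩

end Spectrum

/-! ### Grönwall's inequality -/

section Gronwall

variable {𝕜 : Type*} [RCLike 𝕜] {H : Type*} [NormedAddCommGroup H] [InnerProductSpace 𝕜 H]

/-- Grönwall's inequality for a solution of `u' = -v` (right derivative) with
`Re ⟨v, u⟩ ≥ C ‖u‖²`: the function `exp (2 C t) ‖u t‖²` is nonincreasing. -/
theorem norm_le_exp_mul_of_right_deriv {u v : ℝ≥0 → H} {C : ℝ} (hu : Continuous u)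
    (hd : ∀ t, Tendsto (fun h : ℝ≥0 => (((h : ℝ) : 𝕜)⁻¹) • (u t - u (t + h))) (𝓝[>] 0) (𝓝 (v t)))
    (hC : ∀ t, C * ‖u t‖ ^ 2 ≤ RCLike.re ⟪v t, u t⟫_𝕜) (t : ℝ≥0) :
    ‖u t‖ ≤ Real.exp (-C * t) * ‖u 0‖ := by
  let _ : InnerProductSpace ℝ H := InnerProductSpace.rclikeToReal 𝕜 H
  have hsm : ∀ (r : ℝ) (x : H), r • x = (r : 𝕜) • x := fun _ _ => rfl
  set U : ℝ → H := fun s => u s.toNNReal with hU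
  have hUc : Continuous U := hu.comp continuous_real_toNNReal
  have hUd : ∀ s, 0 ≤ s → HasDerivWithinAt U (-v s.toNNReal) (Set.Ici s) s := by
    intro s hs
    rw [hasDerivWithinAt_iff_tendsto_slope, Set.Ici_sdiff_left]
    have hmap : Tendsto (fun y : ℝ => (y - s).toNNReal) (𝓝[>] s) (𝓝[>] 0) := by
      refine tendsto_nhdsWithin_iff.2 ⟨?_, ?_⟩
      · have : Continuous fun y : ℝ => (y - s).toNNReal := by fun_prop
        have h := this.tendsto s
        simp only [sub_self, Real.toNNReal_zero] at h
        exact h.mono_left nhdsWithin_le_nhds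
      · filter_upwards [self_mem_nhdsWithin] with y hy
        exact Real.toNNReal_pos.2 (sub_pos.2 hy)
    refine ((hd s.toNNReal).comp hmap).neg.congr' ?_
    filter_upwards [self_mem_nhdsWithin] with y hy
    have hys : 0 ≤ y - s := (sub_pos.2 hy).le
    have h1 : s.toNNReal + (y - s).toNNReal = y.toNNReal := by
      rw [← Real.toNNReal_add hs hys, add_sub_cancel]
    simp only [Function.comp, slope, vsub_eq_sub, hU, h1, Real.coe_toNNReal _ hys, hsm,
      RCLike.ofReal_inv]
    rw [← smul_neg, neg_sub]
  have hF := image_le_of_deriv_right_le_deriv_boundary (a := 0) (b := t)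
    (f := fun s => Real.exp (2 * C * s) * ‖U s‖ ^ 2)
    (f' := fun s => Real.exp (2 * C * s) * (2 * C) * ‖U s‖ ^ 2
      + Real.exp (2 * C * s) * (2 * inner ℝ (U s) (-v s.toNNReal)))
    (B := fun _ => ‖U 0‖ ^ 2) (B' := fun _ => 0)
    (by fun_prop)
    (fun s hs => by
      have h1 : HasDerivAt (fun s => Real.exp (2 * C * s)) (Real.exp (2 * C * s) * (2 * C)) s := by
        simpa using ((hasDerivAt_id s).const_mul (2 * C)).exp
      exact h1.hasDerivWithinAt.mul (hUd s hs.1).norm_sq)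
    (by simp) continuousOn_const (fun s _ => hasDerivWithinAt_const _ _ _)
    (fun s hs => by
      have h1 : inner ℝ (U s) (-v s.toNNReal) = -RCLike.re ⟪v s.toNNReal, U s⟫_𝕜 := by
        rw [inner_neg_right, real_inner_comm]; rfl
      have h2 : C * ‖U s‖ ^ 2 ≤ RCLike.re ⟪v s.toNNReal, U s⟫_𝕜 := hC _
      rw [h1]
      nlinarith [Real.exp_pos (2 * C * s)])
    (Set.right_mem_Icc.2 t.2)
  simp only [hU, Real.toNNReal_coe, Real.toNNReal_zero] at hF
  refine (sq_le_sq₀ (norm_nonneg _) (by positivity)).1 ?_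
  rw [mul_pow, ← Real.exp_nat_mul]
  have h3 : Real.exp (((2 : ℕ) : ℝ) * (-C * t)) * Real.exp (2 * C * t) = 1 := by
    rw [← Real.exp_add, ← Real.exp_zero]; congr 1; push_cast; ring
  calc ‖u t‖ ^ 2 = Real.exp (((2 : ℕ) : ℝ) * (-C * t)) * (Real.exp (2 * C * t) * ‖u t‖ ^ 2) := by
        rw [← mul_assoc, h3, one_mul]
    _ ≤ _ := mul_le_mul_of_nonneg_left hF (Real.exp_pos _).le

end Gronwall

/-! ### Semigroups with bounded generator -/

section BoundedGenerator

variable {𝕜 : Type*} [RCLike 𝕜] {H : Type*} [NormedAddCommGroup H] [InnerProductSpace 𝕜 H]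

/-- The semigroup `t ↦ e^{-tA}` of a bounded operator `A`, given by the exponential series. -/
noncomputable def boundedExpNeg (A : H →L[𝕜] H) (t : ℝ≥0) : H →L[𝕜] H :=
  NormedSpace.exp (((t : ℝ) : 𝕜) • (-A))

lemma boundedExpNeg_zero (A : H →L[𝕜] H) : boundedExpNeg A 0 = 1 := by
  simp [boundedExpNeg]

variable [CompleteSpace H]

lemma exp_add_smul (B : H →L[𝕜] H) (a b : 𝕜) :
    NormedSpace.exp ((a + b) • B) = NormedSpace.exp (a • B) * NormedSpace.exp (b • B) := by
  rw [add_smul]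
  exact NormedSpace.exp_add_of_commute_of_mem_ball (𝕂 := 𝕜)
    (((Commute.refl B).smul_left a).smul_right b)
    ((NormedSpace.expSeries_radius_eq_top 𝕜 (H →L[𝕜] H)).symm ▸ edist_lt_top _ _)
    ((NormedSpace.expSeries_radius_eq_top 𝕜 (H →L[𝕜] H)).symm ▸ edist_lt_top _ _)

lemma boundedExpNeg_add (A : H →L[𝕜] H) (s t : ℝ≥0) :
    boundedExpNeg A (s + t) = boundedExpNeg A s * boundedExpNeg A t := by
  simp only [boundedExpNeg, NNReal.coe_add, RCLike.ofReal_add, exp_add_smul]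

lemma continuous_boundedExpNeg (A : H →L[𝕜] H) (x : H) :
    Continuous fun t => boundedExpNeg A t x := by
  have h1 : Continuous fun s : 𝕜 => NormedSpace.exp (s • (-A)) :=
    continuous_iff_continuousAt.2 fun s => (hasDerivAt_exp_smul_const (-A) s).continuousAt
  have h2 : Continuous fun t : ℝ≥0 => ((t : ℝ) : 𝕜) :=
    RCLike.continuous_ofReal.comp NNReal.continuous_coe
  exact (ContinuousLinearMap.apply 𝕜 H x).continuous.comp (h1.comp h2)

lemma tendsto_coe_nhdsGT_zero :
    Tendsto (fun h : ℝ≥0 => ((h : ℝ) : 𝕜)) (𝓝[>] 0) (𝓝[≠] 0) := by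
  refine tendsto_nhdsWithin_iff.2 ⟨?_, ?_⟩
  · have : Continuous fun t : ℝ≥0 => ((t : ℝ) : 𝕜) :=
      RCLike.continuous_ofReal.comp NNReal.continuous_coe
    have h := this.tendsto 0
    simp only [NNReal.coe_zero, RCLike.ofReal_zero] at h
    exact h.mono_left nhdsWithin_le_nhds
  · filter_upwards [self_mem_nhdsWithin] with h hh
    have : (h : ℝ) ≠ 0 := NNReal.coe_ne_zero.2 (ne_of_gt hh)
    simpa using this

lemma tendsto_boundedExpNeg_slope_zero (A : H →L[𝕜] H) (x : H) :
    Tendsto (fun h : ℝ≥0 => (((h : ℝ) : 𝕜)⁻¹) • (x - boundedExpNeg A h x)) (𝓝[>] 0)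
      (𝓝 (A x)) := by
  have h1 : HasDerivAt (fun s : 𝕜 => NormedSpace.exp (s • (-A)) x) (-A x) 0 := by
    have := ((ContinuousLinearMap.apply 𝕜 H x).hasFDerivAt).comp_hasDerivAt (0 : 𝕜)
      (hasDerivAt_exp_smul_const (-A) (0 : 𝕜))
    simpa [Function.comp_def] using this
  have h2 := (h1.tendsto_slope.comp (tendsto_coe_nhdsGT_zero (𝕜 := 𝕜))).neg
  rw [neg_neg] at h2
  refine h2.congr fun h => ?_
  simp only [Function.comp, slope, vsub_eq_sub, sub_zero, zero_smul, NormedSpace.exp_zero,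
    one_apply_eq_self, boundedExpNeg]
  rw [← smul_neg, neg_sub]

lemma norm_boundedExpNeg_apply_le {A : H →L[𝕜] H} (hA : ∀ x, 0 ≤ RCLike.re ⟪A x, x⟫_𝕜)
    (t : ℝ≥0) (x : H) : ‖boundedExpNeg A t x‖ ≤ ‖x‖ := by
  have := norm_le_exp_mul_of_right_deriv (𝕜 := 𝕜) (C := 0) (u := fun t => boundedExpNeg A t x)
    (v := fun t => A (boundedExpNeg A t x)) (continuous_boundedExpNeg A x)
    (fun t => by
      refine (tendsto_boundedExpNeg_slope_zero A (boundedExpNeg A t x)).congr fun h => ?_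
      rw [add_comm t h, boundedExpNeg_add]; rfl)
    (fun t => by simpa using hA _) t
  simpa [boundedExpNeg_zero] using this

lemma inner_boundedExpNeg_comm {A : H →L[𝕜] H} (hA : IsSelfAdjoint A) (t : ℝ≥0) (x y : H) :
    ⟪boundedExpNeg A t x, y⟫_𝕜 = ⟪x, boundedExpNeg A t y⟫_𝕜 := by
  have h : IsSelfAdjoint (boundedExpNeg A t) := by
    refine IsSelfAdjoint.exp (IsSelfAdjoint.smul ?_ hA.neg)
    simp [isSelfAdjoint_iff]
  exact h.isSymmetric x y

/-- For commuting accretive bounded operators the mean value inequality, applied to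
`s ↦ e^{-(t-s)B} e^{-sA} x` on `[0, t]`, compares the two semigroups. -/
lemma norm_boundedExpNeg_sub_le {A B : H →L[𝕜] H} (hA : ∀ x, 0 ≤ RCLike.re ⟪A x, x⟫_𝕜)
    (hB : ∀ x, 0 ≤ RCLike.re ⟪B x, x⟫_𝕜) (hAB : Commute A B) (t : ℝ≥0) (x : H) :
    ‖boundedExpNeg A t x - boundedExpNeg B t x‖ ≤ t * ‖A x - B x‖ := by
  set τ : 𝕜 := ((t : ℝ) : 𝕜) with hτ
  set F : 𝕜 → (H →L[𝕜] H) := fun s =>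
    NormedSpace.exp ((τ - s) • (-B)) * NormedSpace.exp (s • (-A)) with hF
  have hFd : ∀ s, HasDerivAt F (NormedSpace.exp ((τ - s) • (-B)) *
      NormedSpace.exp (s • (-A)) * (B - A)) s := by
    intro s
    have h1 : HasDerivAt (fun s : 𝕜 => NormedSpace.exp ((τ - s) • (-B)))
        ((-1 : 𝕜) • (NormedSpace.exp ((τ - s) • (-B)) * (-B))) s :=
      (hasDerivAt_exp_smul_const (-B) (τ - s)).scomp s ((hasDerivAt_id s).const_sub τ)
    have h2 := h1.mul (hasDerivAt_exp_smul_const (-A) s)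
    refine h2.congr_deriv ?_
    have hc : Commute B (NormedSpace.exp (s • (-A))) :=
      ((hAB.symm.neg_right).smul_right s).exp_right
    rw [neg_one_smul, mul_neg, neg_neg, mul_assoc, hc.eq]
    noncomm_ring
  have hconv : Convex ℝ (RCLike.ofRealCLM (K := 𝕜) '' Set.Icc 0 (t : ℝ)) :=
    (convex_Icc _ _).is_linear_image (RCLike.ofRealCLM (K := 𝕜)).toLinearMap.isLinear
  have key := hconv.norm_image_sub_le_of_norm_hasDerivWithin_le (𝕜 := 𝕜)
    (f := fun s => F s x)
    (f' := fun s => (NormedSpace.exp ((τ - s) • (-B)) *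
      NormedSpace.exp (s • (-A)) * (B - A)) x) (C := ‖A x - B x‖)
    (x := 0) (y := τ)
    (fun s _ => (((ContinuousLinearMap.apply 𝕜 H x).hasFDerivAt).comp_hasDerivAt s
      (hFd s)).hasDerivWithinAt)
    (by
      rintro _ ⟨s, hs, rfl⟩
      have e1 : (τ - RCLike.ofRealCLM (K := 𝕜) s) = (((t - s.toNNReal : ℝ≥0) : ℝ) : 𝕜) := by
        rw [NNReal.coe_sub (Real.toNNReal_le_iff_le_coe.2 hs.2), Real.coe_toNNReal _ hs.1]
        simp [hτ]
      have e2 : RCLike.ofRealCLM (K := 𝕜) s = ((s.toNNReal : ℝ) : 𝕜) := by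
        rw [Real.coe_toNNReal _ hs.1]; rfl
      rw [e1, e2]
      change ‖boundedExpNeg B _ (boundedExpNeg A _ ((B - A) x))‖ ≤ _
      refine (norm_boundedExpNeg_apply_le hB _ _).trans
        ((norm_boundedExpNeg_apply_le hA _ _).trans ?_)
      rw [norm_sub_rev]; rfl)
    ⟨0, ⟨le_rfl, t.2⟩, by simp⟩ ⟨t, ⟨t.2, le_rfl⟩, rfl⟩
  have f1 : F τ x = boundedExpNeg A t x := by simp [hF, boundedExpNeg, hτ]
  have f0 : F 0 x = boundedExpNeg B t x := by simp [hF, boundedExpNeg, hτ]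
  rw [f1, f0, sub_zero, hτ, RCLike.norm_ofReal, NNReal.abs_eq] at key
  rwa [mul_comm]

end BoundedGenerator

/-! ### Yosida approximation -/

section Yosida

variable {𝕜 : Type*} [RCLike 𝕜] {H : Type*} [NormedAddCommGroup H] [InnerProductSpace 𝕜 H]
  {L : H →ₗ.[𝕜] H}

/-- Convergence of uniformly contractive operators to the identity on a dense set
gives convergence everywhere. -/
lemma tendsto_apply_of_dense {J : ℕ → H →L[𝕜] H} (hJ : ∀ n x, ‖J n x‖ ≤ ‖x‖) {D : Set H}
    (hD : Dense D) (h : ∀ x ∈ D, Tendsto (fun n => J n x) atTop (𝓝 x)) (y : H) :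
    Tendsto (fun n => J n y) atTop (𝓝 y) := by
  rw [Metric.tendsto_atTop]
  intro ε hε
  obtain ⟨x, hxy, hx⟩ := Metric.dense_iff.1 hD y (ε / 3) (by positivity)
  obtain ⟨N, hN⟩ := Metric.tendsto_atTop.1 (h x hx) (ε / 3) (by positivity)
  refine ⟨N, fun n hn => ?_⟩
  have h1 := hN n hn
  have h2 : dist (J n y) (J n x) ≤ dist x y := by
    rw [dist_eq_norm, ← map_sub, dist_comm, dist_eq_norm]; exact hJ n _
  have h3 := dist_triangle4 (J n y) (J n x) x y
  have h4 : dist x y < ε / 3 := hxy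
  linarith

/-- A selfadjoint `L ≥ C` is the strong limit, up to the shift by `C`, of commuting nonnegative
bounded operators: the Yosida approximations `k (1 - k (L - C + k)⁻¹)` with `k = n + 1`. -/
lemma exists_yosida_approximation [CompleteSpace H] (hL : IsSelfAdjoint L) {C : ℝ}
    (hC : IsFormLowerBound L C) :
    ∃ A : ℕ → H →L[𝕜] H, (∀ n, IsSelfAdjoint (A n)) ∧ (∀ n x, 0 ≤ RCLike.re ⟪A n x, x⟫_𝕜) ∧
      (∀ n k, Commute (A n) (A k)) ∧
      ∀ x : L.domain, Tendsto (fun n => A n x) atTop (𝓝 (L x - (C : 𝕜) • (x : H))) := by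
  have hex : ∀ n : ℕ, ∃ R : H →L[𝕜] H, ‖R‖ ≤ ((n : ℝ) + 1)⁻¹ ∧
      (∀ x : L.domain, R (L x - ((C - (n + 1) : ℝ) : 𝕜) • (x : H)) = x) ∧
      ∀ y : H, ∃ x : L.domain, (x : H) = R y ∧ L x - ((C - (n + 1) : ℝ) : 𝕜) • (x : H) = y :=
    fun n => exists_resolvent hL (by positivity) (by rwa [sub_add_cancel])
  choose R hRn hR1 hR2 using hex
  set c : ℕ → 𝕜 := fun n => (((n : ℝ) + 1 : ℝ) : 𝕜) with hc
  have hcn : ∀ n, ‖c n‖ = (n : ℝ) + 1 := fun n => by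
    rw [hc, RCLike.norm_ofReal, abs_of_nonneg (by positivity)]
  have hcconj : ∀ n, IsSelfAdjoint (c n) := fun n => RCLike.conj_ofReal _
  set J : ℕ → H →L[𝕜] H := fun n => c n • R n with hJ
  have hJle : ∀ n x, ‖J n x‖ ≤ ‖x‖ := by
    intro n x
    have h1 : ‖J n x‖ = ((n : ℝ) + 1) * ‖R n x‖ := by
      rw [hJ, smul_apply, norm_smul, hcn]
    have h2 := (R n).le_of_opNorm_le (hRn n) x
    rw [h1, ← le_div_iff₀' (by positivity), ← inv_mul_eq_div]
    exact h2
  -- `R n` recovers `x` from `(L - C + n + 1) x`, hence `x - J n x = R n (L - C) x`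
  have hxJ : ∀ n (x : L.domain), (x : H) - J n x = R n (L x - (C : 𝕜) • (x : H)) := by
    intro n x
    have h1 : L x - (C : 𝕜) • (x : H) = (L x - ((C - (n + 1) : ℝ) : 𝕜) • (x : H))
        - c n • (x : H) := by
      rw [hc]
      push_cast
      module
    rw [h1, map_sub, hR1, map_smul]
    rfl
  have hJ1 : ∀ y, Tendsto (fun n => J n y) atTop (𝓝 y) := by
    refine tendsto_apply_of_dense hJle hL.dense_domain fun x hx => ?_
    rw [tendsto_iff_norm_sub_tendsto_zero]
    refine squeeze_zero (fun _ => norm_nonneg _) (fun n => ?_)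
      (g := fun n : ℕ => ((n : ℝ) + 1)⁻¹ * ‖L ⟨x, hx⟩ - (C : 𝕜) • x‖) ?_
    · rw [norm_sub_rev, hxJ n ⟨x, hx⟩]
      exact (R n).le_of_opNorm_le (hRn n) _
    · have := (tendsto_one_div_add_atTop_nhds_zero_nat (𝕜 := ℝ)).mul_const
        ‖L ⟨x, hx⟩ - (C : 𝕜) • x‖
      simpa using this
  have hRsa : ∀ n, IsSelfAdjoint (R n) := fun n =>
    (ContinuousLinearMap.isSelfAdjoint_iff_isSymmetric).2 (inner_resolvent_comm hL (hR2 n))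
  -- the resolvent identity
  have hres : ∀ n k y, R n y - R k y = (c k - c n) • R n (R k y) := by
    intro n k y
    obtain ⟨x, hx, hx'⟩ := hR2 k y
    have h1 : y = (L x - ((C - (n + 1) : ℝ) : 𝕜) • (x : H)) + (c k - c n) • (x : H) := by
      nth_rw 1 [← hx']
      rw [hc]
      push_cast
      module
    rw [← hx]
    nth_rw 1 [h1]
    rw [map_add, hR1, map_smul, add_sub_cancel_left]
  have hRcomm : ∀ n k, Commute (R n) (R k) := by
    intro n k
    rcases eq_or_ne n k with rfl | hnk
    · exact Commute.refl _
    ext y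
    have hne : c k - c n ≠ 0 := by
      rw [hc, sub_ne_zero]
      simpa using hnk.symm
    have h1 := hres n k y
    have h2 := hres k n y
    rw [← neg_sub, h1, ← neg_sub (c k), neg_smul, neg_inj] at h2
    exact smul_right_injective H hne h2
  refine ⟨fun n => c n • (1 - J n), fun n => ?_, fun n x => ?_, fun n k => ?_, fun x => ?_⟩
  · exact (hcconj n).smul ((IsSelfAdjoint.one _).sub ((hcconj n).smul (hRsa n)))
  · have h1 : RCLike.re ⟪(c n • (1 - J n)) x, x⟫_𝕜
        = ((n : ℝ) + 1) * (‖x‖ ^ 2 - RCLike.re ⟪J n x, x⟫_𝕜) := by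
      have : (c n • (1 - J n)) x = c n • (x - J n x) := rfl
      rw [this, inner_smul_left, hc, RCLike.conj_ofReal, RCLike.re_ofReal_mul, inner_sub_left,
        map_sub, inner_self_eq_norm_sq]
    rw [h1]
    have h2 : RCLike.re ⟪J n x, x⟫_𝕜 ≤ ‖x‖ ^ 2 :=
      (RCLike.re_le_norm _).trans ((norm_inner_le_norm _ _).trans
        (by nlinarith [hJle n x, norm_nonneg x]))
    exact mul_nonneg (by positivity) (by linarith)
  · have h1 : Commute (J n) (J k) := ((hRcomm n k).smul_left _).smul_right _
    have h2 : Commute (1 - J n) (1 - J k) :=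
      ((Commute.one_left _).sub_left ((Commute.one_right _).sub_right h1))
    exact (h2.smul_left _).smul_right _
  · refine (hJ1 (L x - (C : 𝕜) • (x : H))).congr fun n => ?_
    have : (c n • (1 - J n)) (x : H) = c n • ((x : H) - J n x) := rfl
    rw [this, hxJ]
    rfl

end Yosida

/-! ### The semigroup generated by a selfadjoint operator -/

section Generation

variable {𝕜 : Type*} [RCLike 𝕜] {H : Type*} [NormedAddCommGroup H] [InnerProductSpace 𝕜 H]
  {L : H →ₗ.[𝕜] H}

lemma cauchySeq_apply_of_dense {S : ℕ → H →L[𝕜] H} (hS : ∀ n x, ‖S n x‖ ≤ ‖x‖) {D : Set H}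
    (hD : Dense D) (h : ∀ x ∈ D, CauchySeq fun n => S n x) (y : H) :
    CauchySeq fun n => S n y := by
  rw [Metric.cauchySeq_iff]
  intro ε hε
  obtain ⟨x, hxy, hx⟩ := Metric.dense_iff.1 hD y (ε / 3) (by positivity)
  obtain ⟨N, hN⟩ := Metric.cauchySeq_iff.1 (h x hx) (ε / 3) (by positivity)
  refine ⟨N, fun n hn k hk => ?_⟩
  have h1 := hN n hn k hk
  have h2 : ∀ j, dist (S j x) (S j y) ≤ dist x y := fun j => by
    rw [dist_eq_norm, ← map_sub, dist_eq_norm]; exact hS j _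
  have h3 := dist_triangle4 (S n y) (S n x) (S k x) (S k y)
  have h4 : dist x y < ε / 3 := hxy
  have h5 := h2 n
  rw [dist_comm] at h5
  linarith [h2 k]

/-- The strong limit of the semigroups generated by the Yosida approximations is a symmetric strongly
continuous semigroup, differentiable at `0` on the domain of `L` with derivative `-(L - C)`. -/
lemma exists_contraction_semigroup [CompleteSpace H] (hL : IsSelfAdjoint L) {C : ℝ}
    (hC : IsFormLowerBound L C) :
    ∃ S : ℝ≥0 → H →L[𝕜] H, IsC0Semigroup S ∧ (∀ t x y, ⟪S t x, y⟫_𝕜 = ⟪x, S t y⟫_𝕜) ∧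
      ∀ x : L.domain, Tendsto (fun t : ℝ≥0 => (((t : ℝ) : 𝕜)⁻¹) • ((x : H) - S t x)) (𝓝[>] 0)
        (𝓝 (L x - (C : 𝕜) • (x : H))) := by
  obtain ⟨A, hAsa, hApos, hAcomm, hAlim⟩ := exists_yosida_approximation hL hC
  have hcontr : ∀ n t x, ‖boundedExpNeg (A n) t x‖ ≤ ‖x‖ := fun n =>
    norm_boundedExpNeg_apply_le (hApos n)
  have hcauchy : ∀ t x, CauchySeq fun n => boundedExpNeg (A n) t x := by
    intro t
    refine cauchySeq_apply_of_dense (fun n => hcontr n t) hL.dense_domain fun x hx => ?_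
    have hA := (hAlim ⟨x, hx⟩).cauchySeq
    rw [Metric.cauchySeq_iff] at hA ⊢
    intro ε hε
    obtain ⟨N, hN⟩ := hA (ε / (t + 1)) (by positivity)
    refine ⟨N, fun n hn k hk => ?_⟩
    have h1 := hN n hn k hk
    rw [dist_eq_norm] at h1 ⊢
    rw [lt_div_iff₀ (by positivity)] at h1
    have h2 := norm_boundedExpNeg_sub_le (hApos n) (hApos k) (hAcomm n k) t x
    nlinarith [norm_nonneg (A n x - A k x)]
  choose f hf using fun t x => cauchySeq_tendsto_of_complete (hcauchy t x)
  let S : ℝ≥0 → H →L[𝕜] H := fun t =>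
    continuousLinearMapOfTendsto (fun n => boundedExpNeg (A n) t) (f := f t)
      (tendsto_pi_nhds.2 (hf t))
  have hS : ∀ t x, Tendsto (fun n => boundedExpNeg (A n) t x) atTop (𝓝 (S t x)) := hf
  have hScontr : ∀ t x, ‖S t x‖ ≤ ‖x‖ := fun t x =>
    le_of_tendsto (hS t x).norm (Eventually.of_forall fun n => hcontr n t x)
  have hrate : ∀ (t : ℝ≥0) n (x : L.domain), ‖boundedExpNeg (A n) t x - S t x‖ ≤
      t * ‖A n x - (L x - (C : 𝕜) • (x : H))‖ := by
    intro t n x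
    refine le_of_tendsto_of_tendsto (tendsto_const_nhds.sub (hS t x)).norm
      ((tendsto_const_nhds.sub (hAlim x)).norm.const_mul (t : ℝ)) (Eventually.of_forall fun k => ?_)
    exact norm_boundedExpNeg_sub_le (hApos n) (hApos k) (hAcomm n k) t x
  have h0 : S 0 = 1 := by
    ext x
    refine tendsto_nhds_unique (hS 0 x) ?_
    simp [boundedExpNeg_zero]
  have hadd : ∀ s t, S (s + t) = S s * S t := by
    intro s t
    ext x
    refine tendsto_nhds_unique (hS (s + t) x) ?_
    have h1 : Tendsto (fun n => boundedExpNeg (A n) s (boundedExpNeg (A n) t x - S t x)) atTop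
        (𝓝 0) := by
      refine squeeze_zero_norm (fun n => hcontr n s _) ?_
      exact tendsto_iff_norm_sub_tendsto_zero.1 (hS t x)
    have h2 := h1.add (hS s (S t x))
    rw [zero_add] at h2
    refine h2.congr fun n => ?_
    rw [boundedExpNeg_add, map_sub, sub_add_cancel]
    rfl
  -- the difference quotients of the approximating semigroups are uniformly close to those of `S`
  have hdiff : ∀ x : L.domain, Tendsto (fun t : ℝ≥0 => (((t : ℝ) : 𝕜)⁻¹) • ((x : H) - S t x))
      (𝓝[>] 0) (𝓝 (L x - (C : 𝕜) • (x : H))) := by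
    intro x
    rw [Metric.tendsto_nhds]
    intro ε hε
    obtain ⟨n, hn⟩ := ((Metric.tendsto_nhds.1 (hAlim x)) (ε / 3) (by positivity)).exists
    have h1 := Metric.tendsto_nhds.1 (tendsto_boundedExpNeg_slope_zero (A n) (x : H)) (ε / 3)
      (by positivity)
    filter_upwards [h1, self_mem_nhdsWithin] with t ht htpos
    have htpos' : (0 : ℝ) < t := htpos
    have h2 : dist ((((t : ℝ) : 𝕜)⁻¹) • ((x : H) - S t x))
        ((((t : ℝ) : 𝕜)⁻¹) • ((x : H) - boundedExpNeg (A n) t x)) ≤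
        dist (A n x) (L x - (C : 𝕜) • (x : H)) := by
      rw [dist_eq_norm, dist_eq_norm, ← smul_sub, sub_sub_sub_cancel_left, norm_smul, norm_inv,
        RCLike.norm_ofReal, abs_of_pos htpos', inv_mul_le_iff₀ htpos']
      exact hrate t n x
    have h3 := dist_triangle4 ((((t : ℝ) : 𝕜)⁻¹) • ((x : H) - S t x))
      ((((t : ℝ) : 𝕜)⁻¹) • ((x : H) - boundedExpNeg (A n) t x)) (A n x)
      (L x - (C : 𝕜) • (x : H))
    linarith
  -- contractivity and the semigroup law reduce continuity to continuity at `0`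
  have hcont : ∀ x, Continuous fun t => S t x := by
    have hloc : ∀ x, ∀ (s t : ℝ≥0), ‖S (s + t) x - S s x‖ ≤ ‖S t x - x‖ := by
      intro x s t
      have : S (s + t) x - S s x = S s (S t x - x) := by rw [hadd, map_sub]; rfl
      rw [this]
      exact hScontr s _
    have hdist : ∀ x s t, dist (S s x) (S t x) ≤ ‖S (nndist s t) x - x‖ := by
      intro x s t
      wlog hst : t ≤ s generalizing s t
      · rw [dist_comm, nndist_comm]; exact this t s (le_of_not_ge hst)
      have h1 : s = t + nndist s t := by
        rw [NNReal.nndist_eq, max_eq_left (by simp [tsub_eq_zero_of_le hst]),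
          add_tsub_cancel_of_le hst]
      rw [dist_eq_norm]
      nth_rw 1 [h1]
      exact hloc x t _
    have hzero : ∀ x, Tendsto (fun t => ‖S t x - x‖) (𝓝 0) (𝓝 0) := by
      have hdom : ∀ x : L.domain, Tendsto (fun t => ‖S t x - x‖) (𝓝 0) (𝓝 0) := by
        intro x
        have hlip : ∀ t : ℝ≥0, ‖S t x - x‖ ≤ t * ‖L x - (C : 𝕜) • (x : H)‖ := by
          intro t
          have hb : ∀ n, ‖boundedExpNeg (A n) t x - x‖ ≤ t * ‖A n x‖ := by
            intro n
            have := norm_boundedExpNeg_sub_le (B := 0) (hApos n) (fun x => by simp)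
              (Commute.zero_right _) t (x : H)
            simpa [boundedExpNeg] using this
          exact le_of_tendsto_of_tendsto ((hS t x).sub_const _).norm
            ((hAlim x).norm.const_mul (t : ℝ)) (Eventually.of_forall hb)
        refine squeeze_zero (fun _ => norm_nonneg _) hlip ?_
        have : Continuous fun t : ℝ≥0 => (t : ℝ) * ‖L x - (C : 𝕜) • (x : H)‖ := by fun_prop
        simpa using this.tendsto 0
      intro y
      rw [Metric.tendsto_nhds]
      intro ε hε
      obtain ⟨x, hxy, hx⟩ := Metric.dense_iff.1 hL.dense_domain y (ε / 3) (by positivity)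
      filter_upwards [Metric.tendsto_nhds.1 (hdom ⟨x, hx⟩) (ε / 3) (by positivity)] with t ht
      rw [Real.dist_eq, sub_zero, abs_of_nonneg (norm_nonneg _)] at ht ⊢
      have h4 : ‖x - y‖ < ε / 3 := by rw [← dist_eq_norm]; exact hxy
      have h5 : S t y - y = (S t x - x) + ((x - y) - S t (x - y)) := by rw [map_sub]; abel
      rw [h5]
      have h6 := norm_add_le (S t x - x) ((x - y) - S t (x - y))
      have h7 := norm_sub_le (x - y) (S t (x - y))
      have h8 := hScontr t (x - y)
      linarith
    intro x
    rw [continuous_iff_continuousAt]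
    intro t
    rw [ContinuousAt, tendsto_iff_dist_tendsto_zero]
    refine squeeze_zero (fun _ => dist_nonneg) (fun s => hdist x s t) ?_
    have h1 : Tendsto (fun s : ℝ≥0 => nndist s t) (𝓝 t) (𝓝 0) := by
      have : Continuous fun s : ℝ≥0 => nndist s t := by fun_prop
      simpa using this.tendsto t
    exact (hzero x).comp h1
  refine ⟨S, ⟨h0, hadd, hcont⟩, fun t x y => ?_, hdiff⟩
  refine tendsto_nhds_unique ((hS t x).inner tendsto_const_nhds) ?_
  simp_rw [inner_boundedExpNeg_comm (hAsa _)]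
  exact tendsto_const_nhds.inner (hS t y)

/-- A selfadjoint operator `L` that is bounded below generates a symmetric strongly continuous
semigroup. That no larger operator than `L` is generated is due to the maximality of `L`
among its formal adjoints. -/
theorem exists_semigroup [CompleteSpace H] (hL : IsSelfAdjoint L) {C : ℝ}
    (hC : IsFormLowerBound L C) :
    ∃ T : ℝ≥0 → H →L[𝕜] H, IsC0Semigroup T ∧ IsGeneratedByNeg L T ∧
      ∀ t x y, ⟪T t x, y⟫_𝕜 = ⟪x, T t y⟫_𝕜 := by
  obtain ⟨S, hS, hsymm, hdiff⟩ := exists_contraction_semigroup hL hC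
  -- undo the shift by `C`
  set e : ℝ≥0 → 𝕜 := fun t => ((Real.exp (-C * t) : ℝ) : 𝕜) with he
  have hecont : Continuous e := by
    have h1 : Continuous fun t : ℝ≥0 => Real.exp (-C * t) := by fun_prop
    exact RCLike.continuous_ofReal.comp h1
  have he0 : e 0 = 1 := by simp [he]
  have headd : ∀ s t, e (s + t) = e s * e t := by
    intro s t
    simp only [he, NNReal.coe_add, mul_add, Real.exp_add, RCLike.ofReal_mul]
  have hTsymm : ∀ t x y, ⟪(e t • S t) x, y⟫_𝕜 = ⟪x, (e t • S t) y⟫_𝕜 := by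
    intro t x y
    rw [smul_apply, smul_apply, inner_smul_left, inner_smul_right,
      hsymm, he, RCLike.conj_ofReal]
  have hTdiff : ∀ x : L.domain, Tendsto
      (fun t : ℝ≥0 => (((t : ℝ) : 𝕜)⁻¹) • ((x : H) - (e t • S t) x)) (𝓝[>] 0) (𝓝 (L x)) := by
    intro x
    have h1 : Tendsto (fun t : ℝ≥0 => (((t : ℝ) : 𝕜)⁻¹) * (1 - e t)) (𝓝[>] 0) (𝓝 (C : 𝕜)) := by
      have h2 : HasDerivAt (fun s : ℝ => Real.exp (-C * s)) (-C) 0 := by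
        simpa using ((hasDerivAt_id (0 : ℝ)).const_mul (-C)).exp
      have h3 := ((RCLike.continuous_ofReal (K := 𝕜)).tendsto (-(-C))).comp
        (h2.tendsto_slope.comp (tendsto_coe_nhdsGT_zero (𝕜 := ℝ))).neg
      rw [neg_neg] at h3
      refine h3.congr fun t => ?_
      simp only [Function.comp, slope, vsub_eq_sub, sub_zero, smul_eq_mul, mul_zero, Real.exp_zero,
        he]
      push_cast
      simp only [RCLike.ofReal_real_eq_id, id]
      ring
    have h4 : Tendsto (fun t : ℝ≥0 => e t) (𝓝[>] 0) (𝓝 1) := by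
      rw [← he0]; exact (hecont.tendsto 0).mono_left nhdsWithin_le_nhds
    have h5 := (h4.smul (hdiff x)).add (h1.smul_const (x : H))
    rw [one_smul, sub_add_cancel] at h5
    refine h5.congr fun t => ?_
    rw [smul_apply]
    module
  refine ⟨fun t => e t • S t, ⟨?_, ?_, ?_⟩, fun x y => ⟨fun hxy => ?_, fun hxy => ?_⟩, hTsymm⟩
  · simp only [he0, hS.map_zero, one_smul]
  · intro s t
    simp only [hS.map_add, headd, smul_mul_smul_comm]
  · intro x
    exact hecont.smul (hS.continuous x)
  · obtain ⟨x, rfl, rfl⟩ := (LinearPMap.mem_graph_iff _).1 hxy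
    exact hTdiff x
  · refine mem_graph_of_forall_inner hL fun z => ?_
    refine tendsto_nhds_unique (hxy.inner tendsto_const_nhds) ?_
    refine (tendsto_const_nhds.inner (hTdiff z)).congr fun t => ?_
    rw [inner_smul_left, inner_smul_right, inner_sub_left, inner_sub_right, hTsymm, map_inv₀,
      RCLike.conj_ofReal]

variable {T T' : ℝ≥0 → H →L[𝕜] H}

/-- The domain of the generator is invariant and `L` commutes with the semigroup. -/
lemma IsGeneratedByNeg.apply_mem_graph (hT : IsC0Semigroup T) (hLT : IsGeneratedByNeg L T)
    (t : ℝ≥0) (x : L.domain) : (T t x, T t (L x)) ∈ L.graph := by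
  rw [hLT]
  refine (((T t).continuous.tendsto _).comp ((hLT _ _).1 (L.mem_graph x))).congr fun h => ?_
  have h1 : T h (T t x) = T t (T h x) := by
    have h2 := hT.map_add h t
    rw [add_comm, hT.map_add] at h2
    exact (DFunLike.congr_fun h2 (x : H)).symm
  simp only [Function.comp, map_smul, map_sub, h1]

lemma IsGeneratedByNeg.tendsto_slope (hT : IsC0Semigroup T) (hLT : IsGeneratedByNeg L T)
    (t : ℝ≥0) (x : L.domain) :
    Tendsto (fun h : ℝ≥0 => (((h : ℝ) : 𝕜)⁻¹) • (T t x - T (t + h) x)) (𝓝[>] 0)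
      (𝓝 (T t (L x))) := by
  refine ((hLT _ _).1 (hLT.apply_mem_graph hT t x)).congr fun h => ?_
  rw [add_comm t h, hT.map_add]
  rfl

lemma norm_apply_le_of_dense {A : H →L[𝕜] H} {D : Set H} (hD : Dense D) {K : ℝ}
    (h : ∀ x ∈ D, ‖A x‖ ≤ K * ‖x‖) (x : H) : ‖A x‖ ≤ K * ‖x‖ :=
  (isClosed_le (by fun_prop) (by fun_prop)).closure_subset_iff (t := {x | ‖A x‖ ≤ K * ‖x‖}).2 h
    (hD x)

/-- A lower bound of the form gives a growth bound for the semigroup. -/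
theorem IsGeneratedByNeg.norm_apply_le [CompleteSpace H] (hL : IsSelfAdjoint L) {C : ℝ}
    (hC : IsFormLowerBound L C) (hT : IsC0Semigroup T) (hLT : IsGeneratedByNeg L T) (t : ℝ≥0)
    (x : H) : ‖T t x‖ ≤ Real.exp (-C * t) * ‖x‖ := by
  refine norm_apply_le_of_dense hL.dense_domain (fun x hx => ?_) x
  have := norm_le_exp_mul_of_right_deriv (u := fun t => T t x) (v := fun t => T t (L ⟨x, hx⟩))
    (hT.continuous x) (fun t => hLT.tendsto_slope hT t ⟨x, hx⟩) (C := C) (fun t => by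
      obtain ⟨y, hy, hy'⟩ := (LinearPMap.mem_graph_iff _).1 (hLT.apply_mem_graph hT t ⟨x, hx⟩)
      simp only at hy hy'
      rw [← hy, ← hy']
      exact hC y) t
  simpa [hT.map_zero] using this

/-- A semigroup is determined by its generator. -/
theorem IsGeneratedByNeg.unique [CompleteSpace H] (hL : IsSelfAdjoint L) {C : ℝ}
    (hC : IsFormLowerBound L C) (hT : IsC0Semigroup T) (hLT : IsGeneratedByNeg L T)
    (hT' : IsC0Semigroup T') (hLT' : IsGeneratedByNeg L T') : T = T' := by
  funext t
  have key : ∀ x, ‖(T t - T' t) x‖ ≤ 0 * ‖x‖ := by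
    refine norm_apply_le_of_dense hL.dense_domain fun x hx => ?_
    have := norm_le_exp_mul_of_right_deriv (u := fun t => T t x - T' t x)
      (v := fun t => T t (L ⟨x, hx⟩) - T' t (L ⟨x, hx⟩))
      ((hT.continuous x).sub (hT'.continuous x))
      (fun t => ((hLT.tendsto_slope hT t ⟨x, hx⟩).sub (hLT'.tendsto_slope hT' t ⟨x, hx⟩)).congr
        fun h => by rw [← smul_sub]; congr 1; simp only; abel) (C := C) (fun t => by
        obtain ⟨y, hy, hy'⟩ := (LinearPMap.mem_graph_iff _).1
          (L.graph.sub_mem (hLT.apply_mem_graph hT t ⟨x, hx⟩)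
            (hLT'.apply_mem_graph hT' t ⟨x, hx⟩))
        simp only [Prod.mk_sub_mk] at hy hy'
        rw [← hy, ← hy']
        exact hC y) t
    simpa [hT.map_zero, hT'.map_zero] using this
  ext x
  have := key x
  rw [zero_mul, norm_le_zero_iff] at this
  exact sub_eq_zero.1 this

/-- The semigroup `e^{-tL}` of a selfadjoint operator that is bounded below is a symmetric strongly
continuous semigroup with generator `-L`. -/
theorem expNeg_spec [CompleteSpace H] (hL : IsSelfAdjoint L) (hbdd : IsBoundedBelow L) :
    IsC0Semigroup (expNeg L) ∧ IsGeneratedByNeg L (expNeg L) ∧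
      ∀ t x y, ⟪expNeg L t x, y⟫_𝕜 = ⟪x, expNeg L t y⟫_𝕜 := by
  obtain ⟨C, hC⟩ := hbdd
  obtain ⟨T, hT, hLT, hsymm⟩ := exists_semigroup hL hC
  have hex : ∃ T : ℝ≥0 → H →L[𝕜] H, IsC0Semigroup T ∧ IsGeneratedByNeg L T := ⟨T, hT, hLT⟩
  have hspec := hex.choose_spec
  have hexp : expNeg L = T := by
    rw [expNeg, dif_pos hex]
    exact hspec.2.unique hL hC hspec.1 hT hLT
  rw [hexp]
  exact ⟨hT, hLT, hsymm⟩

/-- A growth bound for the semigroup bounds the form of its generator from below. -/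
lemma IsGeneratedByNeg.isFormLowerBound (hLT : IsGeneratedByNeg L T) {μ : ℝ}
    (h : ∀ t x, ‖T t x‖ ≤ Real.exp (μ * t) * ‖x‖) : IsFormLowerBound L (-μ) := by
  intro x
  have h1 : Tendsto (fun t : ℝ≥0 => RCLike.re ⟪(((t : ℝ) : 𝕜)⁻¹) • ((x : H) - T t x), (x : H)⟫_𝕜)
      (𝓝[>] 0) (𝓝 (RCLike.re ⟪L x, (x : H)⟫_𝕜)) :=
    (RCLike.continuous_re.tendsto _).comp
      (((hLT _ _).1 (L.mem_graph x)).inner tendsto_const_nhds)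
  have h2 : HasDerivAt (fun s : ℝ => Real.exp (μ * s)) μ 0 := by
    simpa using ((hasDerivAt_id (0 : ℝ)).const_mul μ).exp
  have h3 := (h2.tendsto_slope.comp (tendsto_coe_nhdsGT_zero (𝕜 := ℝ))).neg.mul_const
    (‖(x : H)‖ ^ 2)
  refine le_of_tendsto_of_tendsto h3 h1 ?_
  filter_upwards [self_mem_nhdsWithin] with t ht
  have htpos : (0 : ℝ) < t := ht
  have h4 : RCLike.re ⟪T t x, (x : H)⟫_𝕜 ≤ Real.exp (μ * t) * ‖(x : H)‖ ^ 2 :=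
    (RCLike.re_le_norm _).trans ((norm_inner_le_norm _ _).trans
      (by nlinarith [h t x, norm_nonneg (x : H)]))
  have h5 : RCLike.re ⟪(((t : ℝ) : 𝕜)⁻¹) • ((x : H) - T t x), (x : H)⟫_𝕜
      = (t : ℝ)⁻¹ * (‖(x : H)‖ ^ 2 - RCLike.re ⟪T t x, (x : H)⟫_𝕜) := by
    rw [← RCLike.ofReal_inv, inner_smul_left, RCLike.conj_ofReal, RCLike.re_ofReal_mul,
      inner_sub_left, map_sub, inner_self_eq_norm_sq]
  rw [h5]
  simp only [Function.comp, slope, vsub_eq_sub, sub_zero, smul_eq_mul, mul_zero, Real.exp_zero,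
    RCLike.ofReal_real_eq_id, id]
  have h6 := mul_le_mul_of_nonneg_left h4 (inv_pos.2 htpos).le
  linarith

end Generation

/-! ### Logarithmic convexity of orbits -/

section Convexity

variable {𝕜 : Type*} [RCLike 𝕜] {H : Type*} [NormedAddCommGroup H] [InnerProductSpace 𝕜 H]
  {L : H →ₗ.[𝕜] H} {T : ℝ≥0 → H →L[𝕜] H}

lemma norm_sq_apply_eq (hT : IsC0Semigroup T) (hsymm : ∀ t x y, ⟪T t x, y⟫_𝕜 = ⟪x, T t y⟫_𝕜)
    (t : ℝ≥0) (x : H) : ‖T t x‖ ^ 2 = RCLike.re ⟪x, T (t + t) x⟫_𝕜 := by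
  have h : T (t + t) x = T t (T t x) := by rw [hT.map_add]; rfl
  rw [h, ← hsymm, inner_self_eq_norm_sq]

/-- Logarithmic convexity of `t ↦ ‖T t x‖`, in midpoint form. -/
lemma norm_sq_apply_add_le (hT : IsC0Semigroup T)
    (hsymm : ∀ t x y, ⟪T t x, y⟫_𝕜 = ⟪x, T t y⟫_𝕜) (s t : ℝ≥0) (x : H) :
    ‖T (s + t) x‖ ^ 2 ≤ ‖T (s + s) x‖ * ‖T (t + t) x‖ := by
  have h1 : ∀ a b, T (a + b) x = T a (T b x) := fun a b => by rw [hT.map_add]; rfl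
  have h2 : ⟪T (s + t) x, T (s + t) x⟫_𝕜 = ⟪T (s + s) x, T (t + t) x⟫_𝕜 := by
    rw [h1 s s, hsymm s (T s x), ← h1 s (t + t), ← add_assoc, add_comm (s + t) t, h1 t (s + t),
      ← hsymm t (T s x), ← h1 t s, add_comm t s]
  rw [← inner_self_eq_norm_sq (𝕜 := 𝕜), h2]
  exact (RCLike.re_le_norm _).trans (norm_inner_le_norm _ _)

lemma norm_sq_apply_le (hT : IsC0Semigroup T)
    (hsymm : ∀ t x y, ⟪T t x, y⟫_𝕜 = ⟪x, T t y⟫_𝕜) (t : ℝ≥0) (x : H) :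
    ‖T t x‖ ^ 2 ≤ ‖x‖ * ‖T (t + t) x‖ := by
  simpa [hT.map_zero] using norm_sq_apply_add_le hT hsymm 0 t x

/-- By logarithmic convexity the constant in an exponential growth bound for a single orbit
can be taken to be the norm of its initial value. -/
lemma norm_apply_le_exp_mul_of_bound (hT : IsC0Semigroup T)
    (hsymm : ∀ t x y, ⟪T t x, y⟫_𝕜 = ⟪x, T t y⟫_𝕜) {x : H} {K μ : ℝ}
    (h : ∀ t : ℝ≥0, ‖T t x‖ ≤ K * Real.exp (μ * t)) (t : ℝ≥0) :
    ‖T t x‖ ≤ Real.exp (μ * t) * ‖x‖ := by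
  have hexp : ∀ t : ℝ≥0, Real.exp (μ * t) * Real.exp (-μ * t) = 1 := fun t => by
    rw [← Real.exp_add, ← Real.exp_zero]; congr 1; ring
  set a : ℝ≥0 → ℝ := fun t => Real.exp (-μ * t) * ‖T t x‖ with ha
  have ha0 : ∀ t, 0 ≤ a t := fun t => by positivity
  have hx : a 0 = ‖x‖ := by simp [ha, hT.map_zero]
  have hbdd : BddAbove (Set.range a) := by
    refine ⟨K, ?_⟩
    rintro _ ⟨t, rfl⟩
    calc a t ≤ Real.exp (-μ * t) * (K * Real.exp (μ * t)) :=
          mul_le_mul_of_nonneg_left (h t) (Real.exp_pos _).le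
      _ = K * (Real.exp (μ * t) * Real.exp (-μ * t)) := by ring
      _ = K := by rw [hexp, mul_one]
  -- `M` satisfies `M ^ 2 ≤ ‖x‖ * M`, because `a t ^ 2 ≤ ‖x‖ * a (2 t)`
  set M := ⨆ t, a t
  have haM : ∀ t, a t ≤ M := le_ciSup hbdd
  have hsq : ∀ t, a t ^ 2 ≤ ‖x‖ * M := by
    intro t
    have h1 : a t ^ 2 ≤ ‖x‖ * a (t + t) := by
      have h2 := mul_le_mul_of_nonneg_left (norm_sq_apply_le hT hsymm t x)
        (sq_nonneg (Real.exp (-μ * t)))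
      have h3 : Real.exp (-μ * (t + t : ℝ≥0)) = Real.exp (-μ * t) ^ 2 := by
        rw [sq, ← Real.exp_add]; congr 1; push_cast; ring
      simp only [ha, h3]
      linarith
    exact h1.trans (mul_le_mul_of_nonneg_left (haM _) (norm_nonneg _))
  have hM0 : 0 ≤ M := (ha0 0).trans (haM 0)
  have hMle : M ≤ ‖x‖ := by
    have h1 : M ≤ √(‖x‖ * M) := ciSup_le fun t => Real.le_sqrt_of_sq_le (hsq t)
    have h2 : M ^ 2 ≤ ‖x‖ * M := (Real.le_sqrt hM0 (by positivity)).1 h1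
    rcases eq_or_lt_of_le hM0 with h0 | h0
    · rw [← h0]; exact norm_nonneg x
    · nlinarith
  have h1 := mul_le_mul_of_nonneg_left ((haM t).trans hMle) (Real.exp_pos (μ * t)).le
  calc ‖T t x‖ = (Real.exp (μ * t) * Real.exp (-μ * t)) * ‖T t x‖ := by rw [hexp, one_mul]
    _ = Real.exp (μ * t) * a t := by rw [mul_assoc]
    _ ≤ _ := h1

/-- Logarithmic convexity of an orbit on `[0, s]`: an exponential bound at time `s` bounds the orbit
at all earlier times. -/
lemma norm_apply_le_max (hT : IsC0Semigroup T)
    (hsymm : ∀ t x y, ⟪T t x, y⟫_𝕜 = ⟪x, T t y⟫_𝕜) {x : H} {μ : ℝ} {s : ℝ≥0}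
    (h : ‖T s x‖ ≤ Real.exp (μ * s)) {t : ℝ≥0} (hts : t ≤ s) :
    ‖T t x‖ ≤ max ‖x‖ 1 * Real.exp (μ * t) := by
  have hexp : ∀ t : ℝ≥0, Real.exp (-μ * t) * Real.exp (μ * t) = 1 := fun t => by
    rw [← Real.exp_add, ← Real.exp_zero]; congr 1; ring
  set a : ℝ≥0 → ℝ := fun t => Real.exp (-μ * t) * ‖T t x‖ with ha
  have hx : a 0 = ‖x‖ := by simp [ha, hT.map_zero]
  have has : a s ≤ 1 := by
    rw [← hexp s]
    exact mul_le_mul_of_nonneg_left h (Real.exp_pos _).le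
  have hmid : ∀ p q, a (p + q) ^ 2 ≤ a (p + p) * a (q + q) := by
    intro p q
    have h2 := mul_le_mul_of_nonneg_left (norm_sq_apply_add_le hT hsymm p q x)
      (sq_nonneg (Real.exp (-μ * (p + q : ℝ≥0))))
    have h3 : Real.exp (-μ * (p + q : ℝ≥0)) ^ 2
        = Real.exp (-μ * (p + p : ℝ≥0)) * Real.exp (-μ * (q + q : ℝ≥0)) := by
      rw [sq, ← Real.exp_add, ← Real.exp_add]; congr 1; push_cast; ring
    calc a (p + q) ^ 2 = Real.exp (-μ * (p + q : ℝ≥0)) ^ 2 * ‖T (p + q) x‖ ^ 2 := mul_pow _ _ _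
      _ ≤ _ := h2
      _ = _ := by rw [h3]; simp only [ha]; ring
  have hcont : Continuous a := by
    have := (hT.continuous x).norm
    fun_prop
  obtain ⟨r, ⟨-, hr⟩, hmax⟩ := (isCompact_Icc (a := (0 : ℝ≥0)) (b := s)).exists_isMaxOn
    ⟨0, by simp⟩ hcont.continuousOn
  have hmax' : ∀ q ≤ s, a q ≤ a r := fun q hq => hmax ⟨zero_le, hq⟩
  have har : a r ≤ max ‖x‖ 1 := by
    have h0 : 0 ≤ a r := by positivity
    rcases eq_or_lt_of_le h0 with h0 | h0
    · rw [← h0]; positivity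
    rcases le_total (r + r) s with hrs | hrs
    -- a maximum in the left half is controlled by the value at `0`
    · have h1 := hmid 0 r
      rw [zero_add, zero_add, hx] at h1
      have h2 := mul_le_mul_of_nonneg_left (hmax' _ hrs) (norm_nonneg x)
      exact le_max_of_le_left (by nlinarith)
    -- and one in the right half by the value at `s`
    · have e1 : (r + r - s) / 2 + s / 2 = r := by
        rw [← add_div, tsub_add_cancel_of_le hrs, add_self_div_two]
      have h1 := hmid ((r + r - s) / 2) (s / 2)
      rw [e1, add_halves, add_halves] at h1
      have h2 : r + r - s ≤ s := by
        rw [tsub_le_iff_right]; exact add_le_add hr hr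
      have h3 : a (r + r - s) * a s ≤ a r * 1 :=
        mul_le_mul (hmax' _ h2) has (by positivity) h0.le
      exact le_max_of_le_right (by nlinarith)
  have h1 := mul_le_mul_of_nonneg_right ((hmax' t hts).trans har) (Real.exp_pos (μ * t)).le
  calc ‖T t x‖ = (Real.exp (-μ * t) * Real.exp (μ * t)) * ‖T t x‖ := by rw [hexp, one_mul]
    _ = a t * Real.exp (μ * t) := by simp only [ha]; ring
    _ ≤ _ := h1

/-- A symmetric strongly continuous semigroup is injective: a zero at time `t` propagates to the
times `t / 2 ^ n`. -/
lemma eq_zero_of_apply_eq_zero (hT : IsC0Semigroup T)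
    (hsymm : ∀ t x y, ⟪T t x, y⟫_𝕜 = ⟪x, T t y⟫_𝕜) {t : ℝ≥0} {x : H} (h : T t x = 0) : x = 0 := by
  have h1 : ∀ n : ℕ, T (t * (1 / 2) ^ n) x = 0 := by
    intro n
    induction n with
    | zero => simpa using h
    | succ n ih =>
      have h2 := norm_sq_apply_le hT hsymm (t * (1 / 2) ^ (n + 1)) x
      have h3 : t * (1 / 2) ^ (n + 1) + t * (1 / 2) ^ (n + 1) = t * (1 / 2) ^ n := by
        rw [← mul_add, pow_succ, ← mul_add, add_halves, mul_one]
      rw [h3, ih, norm_zero, mul_zero] at h2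
      exact norm_eq_zero.1 (pow_eq_zero_iff two_ne_zero |>.1 (le_antisymm h2 (sq_nonneg _)))
  have h2 : Tendsto (fun n : ℕ => t * (1 / 2) ^ n) atTop (𝓝 0) := by
    have := (tendsto_pow_atTop_nhds_zero_of_lt_one (r := (1 / 2 : ℝ≥0)) zero_le
      (by rw [← NNReal.coe_lt_coe]; norm_num)).const_mul t
    rwa [mul_zero] at this
  have h3 := ((hT.continuous x).tendsto 0).comp h2
  have h4 : T 0 x = 0 := tendsto_nhds_unique (h3.congr h1) tendsto_const_nhds
  simpa [hT.map_zero] using h4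

/-- The vectors whose orbit is dominated in norm by a multiple of the orbit of `h`. -/
def dominatedBy (T : ℝ≥0 → H →L[𝕜] H) (h : H) : Submodule 𝕜 H where
  carrier := {u | ∃ K : ℝ, ∀ t, ‖T t u‖ ≤ K * ‖T t h‖}
  zero_mem' := ⟨0, fun t => by simp⟩
  add_mem' := by
    rintro u v ⟨K, hK⟩ ⟨K', hK'⟩
    refine ⟨K + K', fun t => ?_⟩
    rw [map_add, add_mul]
    exact (norm_add_le _ _).trans (add_le_add (hK t) (hK' t))
  smul_mem' := by
    rintro c u ⟨K, hK⟩
    refine ⟨‖c‖ * K, fun t => ?_⟩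
    rw [map_smul, norm_smul, mul_assoc]
    exact mul_le_mul_of_nonneg_left (hK t) (norm_nonneg c)

/-- If the vectors dominated by `h` are dense, then the orbit of `h` decays no faster than the
form of `L` allows: a bound `‖T s h‖ ≤ exp (μ s)` for arbitrarily large `s` passes to all times
by convexity, then to a dense set of vectors with optimal constants, hence to `‖T t‖`, so that
`L ≥ -μ`. -/
theorem eventually_exp_lt_norm_apply (hT : IsC0Semigroup T) (hLT : IsGeneratedByNeg L T)
    (hsymm : ∀ t x y, ⟪T t x, y⟫_𝕜 = ⟪x, T t y⟫_𝕜) {h : H}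
    (hdense : Dense (dominatedBy T h : Set H)) {μ : ℝ} (hμ : ¬ IsFormLowerBound L (-μ)) :
    ∀ᶠ s : ℝ≥0 in atTop, Real.exp (μ * s) < ‖T s h‖ := by
  by_contra hcon
  have hfreq : ∃ᶠ s : ℝ≥0 in atTop, ‖T s h‖ ≤ Real.exp (μ * s) :=
    (not_eventually.1 hcon).mono fun s hs => not_lt.1 hs
  have h1 : ∀ t : ℝ≥0, ‖T t h‖ ≤ max ‖h‖ 1 * Real.exp (μ * t) := by
    intro t
    obtain ⟨s, hs, hts⟩ := (hfreq.and_eventually (eventually_ge_atTop t)).exists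
    exact norm_apply_le_max hT hsymm hs hts
  refine hμ (hLT.isFormLowerBound fun t => norm_apply_le_of_dense hdense ?_)
  rintro u ⟨K, hK⟩
  refine norm_apply_le_exp_mul_of_bound hT hsymm (K := |K| * max ‖h‖ 1) (fun s => ?_) t
  rw [mul_assoc]
  exact (hK s).trans (mul_le_mul (le_abs_self K) (h1 s) (norm_nonneg _) (abs_nonneg K))

end Convexity

/-! ### Positivity preserving semigroups -/

section Positivity

variable {𝕜 : Type*} [RCLike 𝕜] {X : Type*} [MeasurableSpace X] {m : Measure X}
  {T : ℝ≥0 → Lp 𝕜 2 m →L[𝕜] Lp 𝕜 2 m}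

lemma IsPositivityPreserving.apply_nonneg (hpos : IsPositivityPreserving T) (hT : IsC0Semigroup T)
    (t : ℝ≥0) {f : Lp 𝕜 2 m} (hf : ∀ᵐ x ∂m, 0 ≤ f x) : ∀ᵐ x ∂m, 0 ≤ T t f x := by
  rcases eq_or_ne t 0 with rfl | ht
  · rwa [hT.map_zero]
  · exact hpos t (pos_iff_ne_zero.2 ht) f hf

lemma ae_sub_nonneg {f g : Lp 𝕜 2 m} (h : ∀ᵐ x ∂m, g x ≤ f x) : ∀ᵐ x ∂m, 0 ≤ (f - g) x := by
  filter_upwards [h, Lp.coeFn_sub f g] with x hx hs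
  rw [hs, Pi.sub_apply]
  exact sub_nonneg.2 hx

lemma IsPositivityPreserving.norm_apply_le (hpos : IsPositivityPreserving T)
    (hT : IsC0Semigroup T) (t : ℝ≥0) {u h : Lp 𝕜 2 m} (hu : ∀ᵐ x ∂m, 0 ≤ u x)
    (huh : ∀ᵐ x ∂m, u x ≤ h x) : ‖T t u‖ ≤ ‖T t h‖ := by
  refine Lp.norm_le_norm_of_ae_le ?_
  have h1 := hpos.apply_nonneg hT t (ae_sub_nonneg huh)
  rw [map_sub] at h1
  filter_upwards [hpos.apply_nonneg hT t hu, h1, Lp.coeFn_sub (T t h) (T t u)] with x hx hx' hs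
  rw [hs, Pi.sub_apply, sub_nonneg] at hx'
  have h2 := RCLike.re_le_re hx'
  have h3 : RCLike.re (T t u x) = ‖T t u x‖ := by
    rw [← RCLike.norm_of_nonneg' hx, RCLike.ofReal_re, RCLike.norm_of_nonneg (norm_nonneg _)]
  rw [← h3]
  exact h2.trans (RCLike.re_le_norm _)

lemma inner_nonneg_of_ae_nonneg {f g : Lp 𝕜 2 m} (hf : ∀ᵐ x ∂m, 0 ≤ f x)
    (hg : ∀ᵐ x ∂m, 0 ≤ g x) : 0 ≤ ⟪f, g⟫_𝕜 := by
  have h1 : ⟪f, g⟫_𝕜 = ((∫ x, ‖f x‖ * ‖g x‖ ∂m : ℝ) : 𝕜) := by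
    rw [L2.inner_def, ← integral_ofReal]
    refine integral_congr_ae ?_
    filter_upwards [hf, hg] with x hx hx'
    rw [RCLike.inner_apply, ← RCLike.norm_of_nonneg' hx, ← RCLike.norm_of_nonneg' hx',
      RCLike.conj_ofReal, RCLike.norm_of_nonneg (norm_nonneg _),
      RCLike.norm_of_nonneg (norm_nonneg _), mul_comm]
    push_cast
    rfl
  rw [h1, RCLike.ofReal_nonneg]
  exact integral_nonneg fun x => by positivity

/-- The real part of `w ⊥ dominatedBy T h` is nonpositive: test `w` against the restriction of `h` to `{Re w > 0}`. -/
lemma ae_re_nonpos_of_mem_orthogonal (hpos : IsPositivityPreserving T) (hT : IsC0Semigroup T)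
    {h : Lp 𝕜 2 m} (hh : IsStrictlyPositive h) {w : Lp 𝕜 2 m} (hw : w ∈ (dominatedBy T h)ᗮ) :
    ∀ᵐ x ∂m, RCLike.re (w x) ≤ 0 := by
  set S : Set X := {x | 0 < RCLike.re (w x)} with hS
  have hSm : MeasurableSet S :=
    measurableSet_lt measurable_const (RCLike.measurable_re.comp (Lp.stronglyMeasurable w).measurable)
  set u : Lp 𝕜 2 m := ((Lp.memLp h).indicator hSm).toLp _
  have hux : ∀ᵐ x ∂m, u x = S.indicator h x := MemLp.coeFn_toLp _
  have hmem : u ∈ dominatedBy T h := by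
    refine ⟨1, fun t => ?_⟩
    rw [one_mul]
    refine hpos.norm_apply_le hT t ?_ ?_
    · filter_upwards [hux, hh] with x hx hx'
      rw [hx]
      by_cases hxS : x ∈ S <;> simp [hxS, hx'.le]
    · filter_upwards [hux, hh] with x hx hx'
      rw [hx]
      by_cases hxS : x ∈ S <;> simp [hxS, hx'.le]
  have h0 : ⟪u, w⟫_𝕜 = 0 := hw u hmem
  have hint := L2.integrable_inner (𝕜 := 𝕜) u w
  have hre : ∀ᵐ x ∂m, RCLike.re ⟪u x, w x⟫_𝕜
      = S.indicator (fun x => RCLike.re (h x) * RCLike.re (w x)) x := by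
    filter_upwards [hux, hh] with x hx hx'
    rw [hx]
    by_cases hxS : x ∈ S
    · rw [Set.indicator_of_mem hxS, Set.indicator_of_mem hxS, RCLike.inner_apply, RCLike.mul_re,
        RCLike.conj_re, RCLike.conj_im, (RCLike.pos_iff.1 hx').2]
      ring
    · simp [Set.indicator_of_notMem hxS]
  have h1 : ∫ x, RCLike.re ⟪u x, w x⟫_𝕜 ∂m = 0 := by
    rw [integral_re hint, ← L2.inner_def, h0, map_zero]
  rw [integral_eq_zero_iff_of_nonneg_ae ?_ hint.re] at h1
  · filter_upwards [h1, hre, hh] with x hx hx' hx''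
    by_contra! hcon
    rw [hx', Set.indicator_of_mem (show x ∈ S from hcon)] at hx
    exact (mul_pos (RCLike.pos_iff.1 hx'').1 hcon).ne' hx
  · filter_upwards [hre, hh] with x hx hx'
    rw [hx]
    by_cases hxS : x ∈ S
    · rw [Set.indicator_of_mem hxS]
      exact (mul_pos (RCLike.pos_iff.1 hx').1 hxS).le
    · rw [Set.indicator_of_notMem hxS]
      rfl

/-- For a positivity preserving semigroup, the vectors dominated by a strictly positive function
are dense. -/
lemma dense_dominatedBy (hpos : IsPositivityPreserving T) (hT : IsC0Semigroup T)
    {h : Lp 𝕜 2 m} (hh : IsStrictlyPositive h) : Dense (dominatedBy T h : Set (Lp 𝕜 2 m)) := by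
  rw [Submodule.dense_iff_topologicalClosure_eq_top, Submodule.topologicalClosure_eq_top_iff,
    Submodule.eq_bot_iff]
  intro w hw
  -- the real parts of all multiples of `w` are nonpositive; `±1` and `±I` suffice
  have key : ∀ c : 𝕜, ∀ᵐ x ∂m, RCLike.re (c * w x) ≤ 0 := by
    intro c
    filter_upwards [ae_re_nonpos_of_mem_orthogonal hpos hT hh (Submodule.smul_mem _ c hw),
      Lp.coeFn_smul c w] with x hx hs
    rwa [hs] at hx
  rw [Lp.eq_zero_iff_ae_eq_zero]
  filter_upwards [key 1, key (-1), key RCLike.I, key (-RCLike.I)] with x h1 h2 h3 h4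
  simp only [one_mul, neg_mul, map_neg, RCLike.I_mul_re] at h1 h2 h3 h4
  refine RCLike.ext ?_ ?_ <;> simp only [Pi.zero_apply, map_zero] <;> linarith

/-- Two strictly positive functions have a common strictly positive lower bound, their minimum. -/
lemma exists_isStrictlyPositive_le {f g : Lp 𝕜 2 m} (hf : IsStrictlyPositive f)
    (hg : IsStrictlyPositive g) : ∃ h : Lp 𝕜 2 m, IsStrictlyPositive h ∧
      (∀ᵐ x ∂m, h x ≤ f x) ∧ ∀ᵐ x ∂m, h x ≤ g x := by
  have hmem : MemLp (fun x => ((min (RCLike.re (f x)) (RCLike.re (g x)) : ℝ) : 𝕜)) 2 m := by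
    refine (Lp.memLp f).of_le ?_ ?_
    · exact RCLike.continuous_ofReal.comp_aestronglyMeasurable
        ((RCLike.continuous_re.comp_aestronglyMeasurable (Lp.aestronglyMeasurable f)).inf
          (RCLike.continuous_re.comp_aestronglyMeasurable (Lp.aestronglyMeasurable g)))
    · filter_upwards [hf, hg] with x hx hx'
      rw [RCLike.norm_of_nonneg (le_min (RCLike.pos_iff.1 hx).1.le (RCLike.pos_iff.1 hx').1.le)]
      exact (min_le_left _ _).trans (RCLike.re_le_norm _)
  refine ⟨hmem.toLp _, ?_, ?_, ?_⟩
  · filter_upwards [hf, hg, hmem.coeFn_toLp] with x hx hx' hh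
    rw [hh, RCLike.ofReal_pos]
    exact lt_min (RCLike.pos_iff.1 hx).1 (RCLike.pos_iff.1 hx').1
  · filter_upwards [hf, hmem.coeFn_toLp] with x hx hh
    rw [hh, RCLike.le_iff_re_im, RCLike.ofReal_re, RCLike.ofReal_im, (RCLike.pos_iff.1 hx).2]
    exact ⟨min_le_left _ _, rfl⟩
  · filter_upwards [hg, hmem.coeFn_toLp] with x hx hh
    rw [hh, RCLike.le_iff_re_im, RCLike.ofReal_re, RCLike.ofReal_im, (RCLike.pos_iff.1 hx).2]
    exact ⟨min_le_right _ _, rfl⟩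

lemma IsStrictlyPositive.ne_zero (hm : m ≠ 0) {f : Lp 𝕜 2 m} (hf : IsStrictlyPositive f) :
    f ≠ 0 := by
  rintro rfl
  have : ∀ᵐ x ∂m, False := by
    filter_upwards [hf, Lp.coeFn_zero 𝕜 2 m] with x hx hx'
    rw [hx'] at hx
    exact lt_irrefl _ hx
  rw [eventually_false_iff_eq_bot, ae_eq_bot] at this
  exact hm this

end Positivity

end GroundState

theorem mainTheorem3 {𝕜 : Type*} [RCLike 𝕜] {X : Type*} [MeasurableSpace X]
    (m : Measure X) [SigmaFinite m] (hm : m ≠ 0)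
    (L : Lp 𝕜 2 m →ₗ.[𝕜] Lp 𝕜 2 m)
    (hL : IsSelfAdjoint L) (hbdd : GroundState.IsBoundedBelow L)
    (hpos : GroundState.IsPositivityPreserving (GroundState.expNeg L))
    (f g : Lp 𝕜 2 m)
    (hf : GroundState.IsStrictlyPositive f) (hg : GroundState.IsStrictlyPositive g) :
    (∀ t : ℝ≥0, 0 < ⟪f, GroundState.expNeg L t g⟫_𝕜) ∧
      Tendsto
        (fun t : ℝ≥0 => Real.log (RCLike.re ⟪f, GroundState.expNeg L t g⟫_𝕜) / (t : ℝ))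
        atTop (𝓝 (-GroundState.groundStateEnergy L)) := by
  obtain ⟨hT, hLT, hsymm⟩ := GroundState.expNeg_spec hL hbdd
  set T := GroundState.expNeg L
  obtain ⟨h, hh, hhf, hhg⟩ := GroundState.exists_isStrictlyPositive_le hf hg
  have : Nontrivial (Lp 𝕜 2 m) := ⟨h, 0, hh.ne_zero hm⟩
  have hE := GroundState.isGreatest_groundStateEnergy hL hbdd
  set E := GroundState.groundStateEnergy L
  have hf0 : ∀ᵐ x ∂m, 0 ≤ f x := hf.mono fun x hx => hx.le
  have hg0 : ∀ᵐ x ∂m, 0 ≤ g x := hg.mono fun x hx => hx.le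
  have hh0 : ∀ᵐ x ∂m, 0 ≤ h x := hh.mono fun x hx => hx.le
  have hnn : ∀ t, 0 ≤ ⟪f, T t g⟫_𝕜 := fun t =>
    GroundState.inner_nonneg_of_ae_nonneg hf0 (hpos.apply_nonneg hT t hg0)
  have hlow : ∀ t : ℝ≥0, ‖T (t / 2) h‖ ^ 2 ≤ RCLike.re ⟪f, T t g⟫_𝕜 := by
    intro t
    rw [GroundState.norm_sq_apply_eq hT hsymm, add_halves]
    have h1 := (RCLike.nonneg_iff.1 (GroundState.inner_nonneg_of_ae_nonneg
      (GroundState.ae_sub_nonneg hhf) (hpos.apply_nonneg hT t hh0))).1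
    have h2 := (RCLike.nonneg_iff.1 (GroundState.inner_nonneg_of_ae_nonneg hf0
      (hpos.apply_nonneg hT t (GroundState.ae_sub_nonneg hhg)))).1
    rw [inner_sub_left, map_sub] at h1
    rw [map_sub, inner_sub_right, map_sub] at h2
    linarith
  have hup : ∀ t : ℝ≥0, RCLike.re ⟪f, T t g⟫_𝕜 ≤ ‖f‖ * ‖g‖ * Real.exp (-E * t) := by
    intro t
    have h1 := hLT.norm_apply_le hL hE.1 hT t g
    refine (RCLike.re_le_norm _).trans ((norm_inner_le_norm _ _).trans ?_)
    calc ‖f‖ * ‖T t g‖ ≤ ‖f‖ * (Real.exp (-E * t) * ‖g‖) :=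
          mul_le_mul_of_nonneg_left h1 (norm_nonneg f)
      _ = _ := by ring
  have hrepos : ∀ t, 0 < RCLike.re ⟪f, T t g⟫_𝕜 := by
    intro t
    refine lt_of_lt_of_le ?_ (hlow t)
    have : T (t / 2) h ≠ 0 := fun h0 =>
      hh.ne_zero hm (GroundState.eq_zero_of_apply_eq_zero hT hsymm h0)
    positivity
  refine ⟨fun t => RCLike.pos_iff.2 ⟨hrepos t, (RCLike.nonneg_iff.1 (hnn t)).2⟩, ?_⟩
  rw [tendsto_order]
  refine ⟨fun a ha => ?_, fun b hb => ?_⟩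
  · have hev := GroundState.eventually_exp_lt_norm_apply hT hLT hsymm
      (GroundState.dense_dominatedBy hpos hT hh) (μ := a)
      (fun hcon => absurd (hE.2 hcon) (by linarith))
    have htend : Tendsto (fun t : ℝ≥0 => t / 2) atTop atTop :=
      tendsto_id.atTop_div_const (by norm_num)
    filter_upwards [htend.eventually hev, eventually_gt_atTop 0] with t ht htpos
    have htpos' : (0 : ℝ) < t := htpos
    rw [lt_div_iff₀ htpos', Real.lt_log_iff_exp_lt (hrepos t)]
    refine lt_of_lt_of_le ?_ (hlow t)
    have h1 : Real.exp (a * t) = Real.exp (a * (t / 2 : ℝ≥0)) ^ 2 := by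
      rw [sq, ← Real.exp_add]; congr 1; push_cast; ring
    rw [h1]
    exact pow_lt_pow_left₀ ht (Real.exp_pos _).le two_ne_zero
  · have hfg : 0 < ‖f‖ * ‖g‖ :=
      mul_pos (norm_pos_iff.2 (hf.ne_zero hm)) (norm_pos_iff.2 (hg.ne_zero hm))
    have hlim : Tendsto (fun t : ℝ≥0 => Real.log (‖f‖ * ‖g‖) / (t : ℝ) + -E) atTop
        (𝓝 (0 + -E)) :=
      (tendsto_const_nhds.div_atTop (NNReal.tendsto_coe_atTop.2 tendsto_id)).add_const _
    rw [zero_add] at hlim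
    filter_upwards [hlim.eventually (gt_mem_nhds hb), eventually_gt_atTop 0] with t ht htpos
    have htpos' : (0 : ℝ) < t := htpos
    refine lt_of_le_of_lt ?_ ht
    rw [div_add' _ _ _ htpos'.ne', div_le_div_iff_of_pos_right htpos']
    have h1 := Real.log_le_log (hrepos t) (hup t)
    rwa [Real.log_mul hfg.ne' (Real.exp_pos _).ne', Real.log_exp] at h1
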